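/- Let $\gamma$ be Euler's constant, let $$E(T)=\int_0^T\left|\zeta(\tfrac12+it)\right|^2dt-T\left(\log\frac{T}{2\pi}+2\gamma-1\right)\qquad(T>0)$$ be the error term in the mean square formula for the Riemann zeta-function on the critical line, and let $k\ge1$ be a fixed integer. Let $\alpha>0$, $\beta\le k-1$ and $C>0$ be real constants, and suppose that for every $\varepsilon>0$ we have $$\int_{T/3}^{3T}\Bigl\{|E(t+2G)-E(t-2G)|^k+|E(t+\tfrac12G)-E(t-\tfrac12G)|^k\Bigr\}\,dt\;\ll_\varepsilon\;T^{\alpha+\varepsilon}G^\beta$$ uniformly for all sufficiently large $T$ (in terms of $\varepsilon$) and all $G$ with $T^\varepsilon\le G\le C\,T^{1/3}$. Then for every $\varepsilon>0$ and all $T\ge1$, $$\int_0^T\left|\zeta(\tfrac12+it)\right|^{2+2k-2\beta}dt\;\ll_\varepsilon\;T^{1+\alpha+\varepsilon},$$ where the implied constant does not depend on $T$. -/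

import Mathlib

noncomputable section

/-- The error term in the mean square formula for the zeta-function on the critical line:
`E(T) = ∫_0^T |ζ(1/2 + it)|² dt - T (log (T / 2π) + 2γ - 1)`. -/
def zetaE (T : ℝ) : ℝ :=
  (∫ t in (0 : ℝ)..T, ‖riemannZeta (1 / 2 + (t : ℂ) * Complex.I)‖ ^ 2) -
    T * (Real.log (T / (2 * Real.pi)) + 2 * Real.eulerMascheroniConstant - 1)

/-- The integral
`∫_{T/3}^{3T} { |E(t + 2G) - E(t - 2G)|^k + |E(t + G/2) - E(t - G/2)|^k } dt`. -/
def shortMoment (k : ℕ) (T G : ℝ) : ℝ :=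
  ∫ t in (T / 3)..(3 * T),
    (|zetaE (t + 2 * G) - zetaE (t - 2 * G)| ^ k +
      |zetaE (t + G / 2) - zetaE (t - G / 2)| ^ k)

end

open Finset Complex Filter
open scoped ComplexConjugate

/-! Put p = 2 + 2k - 2β, so p ≥ 4. The moment bound follows from a pointwise one: ζ(1/2 + it) ≪ (1 +
|t|)^((α + ε)/p), raised to the power p and integrated trivially (`zetaOrderLE_of_moment_bound`,
`ZetaOrderLE.exists_integral_le`).

For the pointwise bound, let A₀ be the infimum of the admissible exponents on the critical line and
suppose A₀ p ≥ α + ε. Choose A just below A₀, so that A is not admissible but A + δ is. Then there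
are arbitrarily large T with V = |ζ(1/2 + iT)| > T^A. Admissibility of A + δ, convexity near the
line and Cauchy's estimate give ζ' ≪ T^(A + 2δ), so |ζ| stays above V/2 on [T, T + η] with η =
T^(-3δ). Take G = V² T^(-5δ). For every t within G of T the window [t - 2G, t + 2G] contains [T, T +
η], and the main term G log T is too small to cancel the mass ηV²/4 found there; hence E(t + 2G) -
E(t - 2G) ≥ ηV²/8. The short moment is therefore at least 2G(ηV²/8)^k, and comparison with T^(α + δ)
G^β yields V^p ≪ T^(α + O(δ)), a contradiction for small δ (`false_of_moment_bound`).

The hypothesis applies only if G ≤ C T^(1/3), which requires A ≤ 1/6. This is why the Weyl exponent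
1/6 is established (`norm_riemannZeta_half_le`), by truncating the zeta series at height about t²
and estimating its dyadic blocks with the Kusmin–Landau inequality, the second-difference test and
van der Corput differencing. -/

/-! ### The Kusmin–Landau inequality. -/

/-- Abel summation for a sum of increments weighted by a bounded antitone sequence. -/
theorem norm_sum_sub_mul_antitone_le (z : ℕ → ℂ) (κ : ℕ → ℝ) (B : ℝ) (N : ℕ)
    (hz : ∀ n, ‖z n‖ ≤ 1) (hκ : ∀ n, n + 1 < N → κ (n + 1) ≤ κ n)
    (hB : ∀ n, n < N → |κ n| ≤ B) (hB0 : 0 ≤ B) :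
    ‖∑ n ∈ range N, (z n - z (n + 1)) * (κ n : ℂ)‖ ≤ 4 * B := by
  rcases N with _ | N
  · simpa using hB0
  have key : ∀ m, m < N + 1 →
      ‖∑ n ∈ range (m + 1), (z n - z (n + 1)) * (κ n : ℂ) + z (m + 1) * (κ m : ℂ)‖
        ≤ B + (κ 0 - κ m) := by
    intro m
    induction m with
    | zero =>
      intro h0
      have : ∑ n ∈ range (0 + 1), (z n - z (n + 1)) * (κ n : ℂ) + z (0 + 1) * (κ 0 : ℂ)
          = z 0 * κ 0 := by simp; ring
      rw [this, norm_mul, Complex.norm_real, Real.norm_eq_abs]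
      have h1 := hB 0 h0
      have h2 := hz 0
      have := mul_le_mul h2 h1 (abs_nonneg _) zero_le_one
      linarith
    | succ m ih =>
      intro hm
      have ih' := ih (by omega)
      have hstep : ∑ n ∈ range (m + 1 + 1), (z n - z (n + 1)) * (κ n : ℂ)
            + z (m + 1 + 1) * (κ (m + 1) : ℂ)
          = (∑ n ∈ range (m + 1), (z n - z (n + 1)) * (κ n : ℂ) + z (m + 1) * (κ m : ℂ))
            + z (m + 1) * ((κ (m + 1) - κ m : ℝ) : ℂ) := by
        rw [Finset.sum_range_succ _ (m + 1)]; push_cast; ring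
      rw [hstep]
      refine (norm_add_le _ _).trans ?_
      rw [norm_mul, Complex.norm_real, Real.norm_eq_abs, abs_of_nonpos (by linarith [hκ m hm])]
      have := mul_le_mul_of_nonneg_right (hz (m + 1)) (by linarith [hκ m hm] :
        0 ≤ -(κ (m + 1) - κ m))
      linarith
  have h := key N (by omega)
  have h0 := abs_le.mp (hB 0 (by omega))
  have hN := abs_le.mp (hB N (by omega))
  have hlast : ‖z (N + 1) * (κ N : ℂ)‖ ≤ B := by
    rw [norm_mul, Complex.norm_real, Real.norm_eq_abs]
    have := mul_le_mul (hz (N + 1)) (hB N (by omega)) (abs_nonneg _) zero_le_one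
    linarith
  have := norm_sub_le (∑ n ∈ range (N + 1), (z n - z (n + 1)) * (κ n : ℂ)
    + z (N + 1) * (κ N : ℂ)) (z (N + 1) * (κ N : ℂ))
  rw [add_sub_cancel_right] at this
  linarith

theorem cot_antitone_of_mem_Ioo {a b : ℝ} (ha : 0 < a) (hab : a ≤ b) (hb : b < Real.pi) :
    Real.cos b / Real.sin b ≤ Real.cos a / Real.sin a := by
  have hsa := Real.sin_pos_of_pos_of_lt_pi ha (by linarith)
  have hsb := Real.sin_pos_of_pos_of_lt_pi (by linarith) hb
  rw [div_le_div_iff₀ hsb hsa]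
  have := Real.sin_nonneg_of_nonneg_of_le_pi (by linarith : 0 ≤ b - a) (by linarith)
  rw [Real.sin_sub] at this
  linarith

theorem div_pi_le_sin {δ x : ℝ} (h1 : δ / 2 ≤ x) (h2 : x ≤ Real.pi - δ / 2) (hδ : 0 < δ) :
    δ / Real.pi ≤ Real.sin x := by
  have hpi := Real.pi_pos
  have e : δ / Real.pi = 2 / Real.pi * (δ / 2) := by ring
  rw [e]
  rcases le_total x (Real.pi / 2) with h | h
  · refine le_trans ?_ (Real.mul_le_sin (by linarith) h)
    gcongr
  · rw [← Real.sin_pi_sub]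
    refine le_trans ?_ (Real.mul_le_sin (by linarith) (by linarith))
    gcongr
    linarith

/-- This is 1/(1 - e^(2ix)) = 1/2 + (i/2) cot x. It writes a term of an exponential sum as a
multiple of its difference with the next term, the multiplier having a monotone cotangent as
imaginary part. -/
theorem one_eq_one_sub_exp_mul {x : ℝ} (hx : Real.sin x ≠ 0) :
    (1 - exp ((2 * x : ℝ) * I)) * (1 / 2 + I * ((Real.cos x / Real.sin x / 2 : ℝ) : ℂ)) = 1 := by
  have hs : Complex.sin (x : ℂ) ≠ 0 := by exact_mod_cast hx
  have hcs := Complex.sin_sq_add_cos_sq (x : ℂ)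
  rw [exp_mul_I]
  push_cast
  rw [Complex.cos_two_mul, Complex.sin_two_mul]
  field_simp
  ring_nf
  simp only [Complex.I_sq]
  have e3 : Complex.cos (x : ℂ) ^ 2 = 1 - Complex.sin (x : ℂ) ^ 2 := by
    rw [← hcs]; ring
  have e4 : Complex.cos (x : ℂ) ^ 3 = Complex.cos (x : ℂ) * (1 - Complex.sin (x : ℂ) ^ 2) := by
    rw [← e3]; ring
  simp only [e3, e4]
  ring

/-- The Kusmin–Landau inequality. -/
theorem norm_sum_exp_le_of_monotone_diff (F : ℕ → ℝ) (N : ℕ) (δ : ℝ) (hδ : 0 < δ)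
    (hmono : ∀ n, n + 1 < N → F (n + 1) - F n ≤ F (n + 2) - F (n + 1))
    (hlo : ∀ n, n < N → δ ≤ F (n + 1) - F n)
    (hhi : ∀ n, n < N → F (n + 1) - F n ≤ 2 * Real.pi - δ) :
    ‖∑ n ∈ range N, exp ((F n : ℂ) * I)‖ ≤ 10 / δ := by
  rcases Nat.eq_zero_or_pos N with rfl | hN
  · simp; positivity
  have hpi := Real.pi_pos
  have hδpi : δ ≤ Real.pi := by linarith [hlo 0 hN, hhi 0 hN]
  set z : ℕ → ℂ := fun n => exp ((F n : ℂ) * I) with hzdef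
  set κ : ℕ → ℝ := fun n =>
    Real.cos ((F (n + 1) - F n) / 2) / Real.sin ((F (n + 1) - F n) / 2) / 2 with hκdef
  have hz : ∀ n, ‖z n‖ ≤ 1 := fun n => by simp [hzdef, Complex.norm_exp_ofReal_mul_I]
  have hsin : ∀ n, n < N → δ / Real.pi ≤ Real.sin ((F (n + 1) - F n) / 2) := fun n hn =>
    div_pi_le_sin (by linarith [hlo n hn]) (by linarith [hhi n hn]) hδ
  have hterm : ∀ n ∈ range N, z n = (z n - z (n + 1)) * (1 / 2)
      + I * ((z n - z (n + 1)) * (κ n : ℂ)) := by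
    intro n hn
    have hn := mem_range.mp hn
    have hs := (lt_of_lt_of_le (by positivity) (hsin n hn)).ne'
    have h1 := one_eq_one_sub_exp_mul hs
    have h2 : z (n + 1) = z n * exp (((2 * ((F (n + 1) - F n) / 2) : ℝ) : ℂ) * I) := by
      simp only [hzdef]
      rw [← exp_add]
      congr 1
      push_cast; ring
    rw [h2]
    linear_combination (-(z n)) * h1
  rw [Finset.sum_congr rfl hterm, Finset.sum_add_distrib, ← Finset.sum_mul, ← Finset.mul_sum,
    Finset.sum_range_sub']
  have hab := norm_sum_sub_mul_antitone_le z κ (Real.pi / (2 * δ)) N hz ?_ ?_ (by positivity)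
  · refine (norm_add_le _ _).trans ?_
    have h1 : ‖(z 0 - z N) * (1 / 2)‖ ≤ 1 := by
      rw [norm_mul]
      have := (norm_sub_le (z 0) (z N)).trans (add_le_add (hz 0) (hz N))
      norm_num
      linarith
    rw [norm_mul I, Complex.norm_I, one_mul]
    have h2 : (1 : ℝ) ≤ Real.pi / δ := by rwa [le_div_iff₀ hδ, one_mul]
    have h3 : 4 * (Real.pi / (2 * δ)) = 2 * (Real.pi / δ) := by field_simp; norm_num
    -- The total is at most 1 + 2π/δ ≤ 3π/δ, and 3π < 10.
    have h5 : 3 * (Real.pi / δ) ≤ 10 / δ := by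
      rw [← mul_div_assoc]; gcongr; linarith [Real.pi_lt_d2]
    linarith
  · intro n hn
    simp only [hκdef]
    have := cot_antitone_of_mem_Ioo (a := (F (n + 1) - F n) / 2)
      (b := (F (n + 1 + 1) - F (n + 1)) / 2) (by linarith [hlo n (by omega)])
      (by linarith [hmono n hn]) (by linarith [hhi (n + 1) hn])
    linarith
  · intro n hn
    have hs := hsin n hn
    have hs0 : 0 < Real.sin ((F (n + 1) - F n) / 2) := lt_of_lt_of_le (by positivity) hs
    simp only [hκdef]
    rw [abs_div, abs_div, abs_of_pos hs0, abs_of_pos (by norm_num : (0:ℝ) < 2)]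
    rw [div_div, div_le_div_iff₀ (by positivity) (by positivity)]
    have hc := Real.abs_cos_le_one ((F (n + 1) - F n) / 2)
    have : δ ≤ Real.pi * Real.sin ((F (n + 1) - F n) / 2) := by
      rw [div_le_iff₀ hpi] at hs; linarith
    nlinarith [abs_nonneg (Real.cos ((F (n + 1) - F n) / 2))]

/-! ### The second-difference test. -/

/-- A nondecreasing finite sequence crosses a threshold once. -/
theorem exists_cut (d : ℕ → ℝ) (N : ℕ) (hd : ∀ n, n + 1 < N → d n ≤ d (n + 1)) (x : ℝ) :
    ∃ a ≤ N, (∀ n < a, d n < x) ∧ ∀ n, a ≤ n → n < N → x ≤ d n := by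
  induction N with
  | zero => exact ⟨0, le_rfl, by simp, by simp⟩
  | succ N ih =>
    obtain ⟨a, ha, h1, h2⟩ := ih fun n hn => hd n (by omega)
    rcases Nat.lt_or_ge a N with h | h
    · refine ⟨a, by omega, h1, fun n hn hnN => ?_⟩
      rcases Nat.lt_or_ge n N with h' | h'
      · exact h2 n hn h'
      · obtain rfl : n = N := by omega
        have := h2 (n - 1) (by omega) (by omega)
        have h3 := hd (n - 1) (by omega)
        rw [Nat.sub_add_cancel (by omega)] at h3
        linarith
    · obtain rfl : a = N := by omega
      rcases lt_or_ge (d a) x with h' | h'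
      · refine ⟨a + 1, le_rfl, fun n hn => ?_, fun n h3 h4 => by omega⟩
        rcases Nat.lt_or_ge n a with h5 | h5
        · exact h1 n h5
        · obtain rfl : n = a := by omega
          exact h'
      · refine ⟨a, by omega, h1, fun n h3 h4 => ?_⟩
        obtain rfl : n = a := by omega
        exact h'

theorem norm_sum_exp_le_card (F : ℕ → ℝ) (N : ℕ) :
    ‖∑ n ∈ range N, exp ((F n : ℂ) * I)‖ ≤ N := by
  refine (norm_sum_le _ _).trans ?_
  simp [Complex.norm_exp_ofReal_mul_I]

theorem mul_le_sub_of_le_increments (d : ℕ → ℝ) (lam : ℝ) (a m : ℕ)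
    (h : ∀ n, a ≤ n → n < a + m → lam ≤ d (n + 1) - d n) :
    m * lam ≤ d (a + m) - d a := by
  induction m with
  | zero => simp
  | succ m ih =>
    have h1 := ih fun n h1 h2 => h n h1 (by omega)
    have h2 := h (a + m) (by omega) (by omega)
    rw [← add_assoc]
    push_cast
    linarith

theorem sum_range_split (f : ℕ → ℂ) {a N : ℕ} (h : a ≤ N) :
    ∑ n ∈ range N, f n = ∑ n ∈ range a, f n + ∑ n ∈ range (N - a), f (a + n) := by
  obtain ⟨b, rfl⟩ := Nat.exists_eq_add_of_le h
  rw [Finset.sum_range_add, Nat.add_sub_cancel_left]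

/-- Exponential sums whose phase increments stay within one period. -/
theorem norm_sum_exp_le_of_diff_mem_period (F : ℕ → ℝ) (N : ℕ) (lam : ℝ) (hlam : 0 < lam)
    (hlam1 : lam ≤ 1)
    (hinc : ∀ n, n + 1 < N → lam ≤ (F (n + 2) - F (n + 1)) - (F (n + 1) - F n))
    (hlo : ∀ n, n < N → 0 ≤ F (n + 1) - F n)
    (hhi : ∀ n, n < N → F (n + 1) - F n < 2 * Real.pi) :
    ‖∑ n ∈ range N, exp ((F n : ℂ) * I)‖ ≤ 14 / √lam := by
  set d : ℕ → ℝ := fun n => F (n + 1) - F n with hd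
  -- Increments within δ of 0 or 2π occupy at most δ/λ + 1 indices at each end, while Kusmin–Landau
  -- gives 10/δ in between; δ = √λ balances the two.
  set δ := √lam with hδdef
  have hδ : 0 < δ := Real.sqrt_pos.mpr hlam
  have hδ1 : δ ≤ 1 := Real.sqrt_le_one.mpr hlam1
  have hsq : δ * δ = lam := Real.mul_self_sqrt hlam.le
  have hmono : ∀ n, n + 1 < N → d n ≤ d (n + 1) := fun n hn => by
    have := hinc n hn
    simp only [hd]
    linarith
  have hinc' : ∀ n, n + 1 < N → lam ≤ d (n + 1) - d n := fun n hn => hinc n hn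
  obtain ⟨a, haN, ha1, ha2⟩ := exists_cut d N hmono δ
  obtain ⟨b, hbN, hb1, hb2⟩ := exists_cut d N hmono (2 * Real.pi - δ)
  have hpi3 := Real.pi_gt_three
  have hab : a ≤ b := by
    by_contra! hcon
    have h1 := ha1 b hcon
    have h2 := hb2 b le_rfl (by omega)
    linarith
  have hshort : ∀ c m : ℕ, c + m ≤ N → (∀ n, c ≤ n → n < c + m → ∀ n', c ≤ n' → n' < c + m →
      d n - d n' ≤ δ) → (m : ℝ) ≤ 1 / δ + 1 := by
    intro c m hcm hdiff
    rcases m with _ | m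
    · simp; positivity
    have h1 := mul_le_sub_of_le_increments d lam c m fun n h1 h2 => hinc' n (by omega)
    have h2 := hdiff (c + m) (by omega) (by omega) c le_rfl (by omega)
    have h3 : (m : ℝ) * δ ≤ 1 := by
      have : ((m : ℝ) * δ) * δ ≤ 1 * δ := by rw [mul_assoc, hsq]; linarith
      exact le_of_mul_le_mul_right this hδ
    push_cast
    have : (m : ℝ) ≤ 1 / δ := by rwa [le_div_iff₀ hδ]
    linarith
  have hA : (a : ℝ) ≤ 1 / δ + 1 := by
    refine hshort 0 a (by omega) fun n _ hn n' _ hn' => ?_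
    have h1 := ha1 n (by omega)
    have h2 := hlo n' (by omega)
    simp only [hd] at h1 ⊢
    linarith
  have hC : ((N - b : ℕ) : ℝ) ≤ 1 / δ + 1 := by
    refine hshort b (N - b) (by omega) fun n _ hn n' hn0 hn' => ?_
    have h1 := hb2 n' hn0 (by omega)
    have h2 := hhi n (by omega)
    simp only [hd] at h1 ⊢
    linarith
  have hB : ‖∑ n ∈ range (b - a), exp ((F (a + n) : ℂ) * I)‖ ≤ 10 / δ := by
    refine norm_sum_exp_le_of_monotone_diff (fun n => F (a + n)) (b - a) δ hδ ?_ ?_ ?_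
    · intro n hn; exact hmono (a + n) (by omega)
    · intro n hn; exact ha2 (a + n) (by omega) (by omega)
    · intro n hn; exact (hb1 (a + n) (by omega)).le
  rw [sum_range_split _ hbN, sum_range_split _ hab]
  refine (norm_add_le _ _).trans ?_
  have h1 := norm_add_le (∑ n ∈ range a, exp ((F n : ℂ) * I))
    (∑ n ∈ range (b - a), exp ((F (a + n) : ℂ) * I))
  have h2 := norm_sum_exp_le_card F a
  have h3 := norm_sum_exp_le_card (fun n => F (b + n)) (N - b)
  have h4 : (1 : ℝ) ≤ 1 / δ := by rwa [le_div_iff₀ hδ, one_mul]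
  have h5 : 14 / δ = 14 * (1 / δ) := by ring
  have h6 : 10 / δ = 10 * (1 / δ) := by ring
  linarith

/-- Lowering every increment of the phase by 2πm leaves the exponentials unchanged, so increments
may be moved to any period. -/
theorem exp_sub_two_pi_mul (F : ℕ → ℝ) (m : ℤ) (n : ℕ) :
    exp (((F n - 2 * Real.pi * m * n : ℝ) : ℂ) * I) = exp ((F n : ℂ) * I) := by
  have := Complex.exp_periodic.sub_zsmul_eq (x := (F n : ℂ) * I) (m * n)
  rw [← this]
  congr 1
  push_cast
  simp
  ring

/-- Increments are nondecreasing, so those in the first period form an initial segment. That segment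
is split off and the rest is moved down by one period. -/
theorem norm_sum_exp_le_of_diff_mem_periods (J : ℕ) : ∀ (F : ℕ → ℝ) (N : ℕ) (lam : ℝ), 0 < lam →
    lam ≤ 1 → (∀ n, n + 1 < N → lam ≤ (F (n + 2) - F (n + 1)) - (F (n + 1) - F n)) →
    (∀ n, n < N → 0 ≤ F (n + 1) - F n) → (∀ n, n < N → F (n + 1) - F n < 2 * Real.pi * J) →
    ‖∑ n ∈ range N, exp ((F n : ℂ) * I)‖ ≤ J * (14 / √lam) := by
  induction J with
  | zero =>
    intro F N lam _ _ _ h1 h2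
    rcases N with _ | N
    · simp
    · have := h1 0 (by omega)
      have := h2 0 (by omega)
      simp at *
      linarith
  | succ J ih =>
    intro F N lam hl hl1 hinc hlo hhi
    obtain ⟨a, haN, ha1, ha2⟩ := exists_cut (fun n => F (n + 1) - F n) N
      (fun n hn => by have := hinc n hn; simp only [add_assoc, Nat.reduceAdd] at this ⊢; linarith)
      (2 * Real.pi)
    rw [sum_range_split _ haN]
    refine (norm_add_le _ _).trans ?_
    have h1 := norm_sum_exp_le_of_diff_mem_period F a lam hl hl1 (fun n hn => hinc n (by omega))
      (fun n hn => hlo n (by omega)) ha1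
    have h2 := ih (fun n => F (a + n) - 2 * Real.pi * (1 : ℤ) * n) (N - a) lam hl hl1 ?_ ?_ ?_
    · have e : ∀ n, exp (((F (a + n) - 2 * Real.pi * (1 : ℤ) * n : ℝ) : ℂ) * I)
          = exp ((F (a + n) : ℂ) * I) := fun n => exp_sub_two_pi_mul (fun n => F (a + n)) 1 n
      simp only [e] at h2
      push_cast
      linarith
    · intro n hn
      have := hinc (a + n) (by omega)
      simp only [add_assoc] at this ⊢
      push_cast
      linarith
    · intro n hn
      have := ha2 (a + n) (by omega) (by omega)
      simp only [add_assoc] at this ⊢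
      push_cast
      linarith
    · intro n hn
      have := hhi (a + n) (by omega)
      simp only [add_assoc] at this ⊢
      push_cast at this ⊢
      linarith

/-- The van der Corput second-difference test. -/
theorem norm_sum_exp_le_of_second_diff (F : ℕ → ℝ) (N : ℕ) (lam mu : ℝ) (hlam : 0 < lam)
    (hlam1 : lam ≤ 1)
    (hinc : ∀ n, n + 1 < N → lam ≤ (F (n + 2) - F (n + 1)) - (F (n + 1) - F n))
    (hinc' : ∀ n, n + 1 < N → (F (n + 2) - F (n + 1)) - (F (n + 1) - F n) ≤ mu) (hmu : 0 ≤ mu) :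
    ‖∑ n ∈ range N, exp ((F n : ℂ) * I)‖ ≤ (N * mu + 2) * (14 / √lam) := by
  have hpi3 := Real.pi_gt_three
  have hpi : 0 < 2 * Real.pi := by linarith
  set m : ℤ := ⌊(F 1 - F 0) / (2 * Real.pi)⌋ with hm
  have hm1 : (m : ℝ) * (2 * Real.pi) ≤ F 1 - F 0 := by
    rw [← le_div_iff₀ hpi]; exact Int.floor_le _
  have hm2 : F 1 - F 0 < ((m : ℝ) + 1) * (2 * Real.pi) := by
    rw [← div_lt_iff₀ hpi]; exact Int.lt_floor_add_one _
  -- The increments spread over a length at most Nμ after the first; the extra period allows for the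
  -- first one, which lies anywhere in [0, 2π) once reduced.
  set J : ℕ := ⌈N * mu / (2 * Real.pi)⌉₊ + 1 with hJ
  have hnn : 0 ≤ N * mu / (2 * Real.pi) := by positivity
  have hJ1 : N * mu / (2 * Real.pi) + 1 ≤ J := by
    rw [hJ]; push_cast; linarith [Nat.le_ceil (N * mu / (2 * Real.pi))]
  have hJ2 : (J : ℝ) ≤ N * mu + 2 := by
    rw [hJ]; push_cast
    have h1 := (Nat.ceil_lt_add_one hnn).le
    have h2 : N * mu / (2 * Real.pi) ≤ N * mu := div_le_self (by positivity) (by linarith)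
    linarith
  have hd1 : ∀ n, n < N → n * lam ≤ (F (n + 1) - F n) - (F 1 - F 0) := by
    intro n hn
    have := mul_le_sub_of_le_increments (fun n => F (n + 1) - F n) lam 0 n
      fun i _ hi => hinc i (by omega)
    simpa using this
  have hd2 : ∀ n, n < N → (F (n + 1) - F n) - (F 1 - F 0) ≤ n * mu := by
    intro n hn
    have := mul_le_sub_of_le_increments (fun n => -(F (n + 1) - F n)) (-mu) 0 n
      fun i _ hi => by have := hinc' i (by omega); simp only [add_assoc, Nat.reduceAdd]; linarith
    simp at this
    linarith
  have h := norm_sum_exp_le_of_diff_mem_periods J (fun n => F n - 2 * Real.pi * m * n) N lam hlam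
    hlam1 ?_ ?_ ?_
  · simp only [exp_sub_two_pi_mul] at h
    refine h.trans ?_
    gcongr
  · intro n hn
    have := hinc n hn
    push_cast
    linarith
  · intro n hn
    have := hd1 n hn
    have h0 : 0 ≤ (n : ℝ) * lam := by positivity
    push_cast
    linarith
  · intro n hn
    have h1 := hd2 n hn
    have h2 : (n : ℝ) * mu ≤ N * mu := by gcongr
    have h3 : N * mu + 2 * Real.pi ≤ 2 * Real.pi * J := by
      have := mul_le_mul_of_nonneg_left hJ1 hpi.le
      rw [mul_add, mul_div_cancel₀ _ hpi.ne'] at this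
      linarith
    push_cast
    linarith

/-! ### Abel summation and van der Corput differencing. -/

/-- Abel summation with nonnegative antitone weights. -/
theorem norm_sum_antitone_mul_le (w : ℕ → ℝ) (z : ℕ → ℂ) (N : ℕ) (B : ℝ)
    (hw0 : ∀ n, 0 ≤ w n) (hw : ∀ n, w (n + 1) ≤ w n)
    (hB : ∀ m ≤ N, ‖∑ n ∈ range m, z n‖ ≤ B) :
    ‖∑ n ∈ range N, (w n : ℂ) * z n‖ ≤ w 0 * B := by
  have hB0 : 0 ≤ B := (norm_nonneg _).trans (hB 0 (by omega))
  rcases N with _ | N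
  · simpa using mul_nonneg (hw0 0) hB0
  have key : ∀ m ≤ N, ‖∑ n ∈ range (m + 1), (w n : ℂ) * z n
      - w m * ∑ n ∈ range (m + 1), z n‖ ≤ B * (w 0 - w m) := by
    intro m
    induction m with
    | zero => simp
    | succ m ih =>
      intro hm
      have ih' := ih (by omega)
      have e : ∑ n ∈ range (m + 1 + 1), (w n : ℂ) * z n
          - w (m + 1) * ∑ n ∈ range (m + 1 + 1), z n
          = (∑ n ∈ range (m + 1), (w n : ℂ) * z n - w m * ∑ n ∈ range (m + 1), z n)
            + ((w m - w (m + 1) : ℝ) : ℂ) * ∑ n ∈ range (m + 1), z n := by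
        rw [Finset.sum_range_succ _ (m + 1), Finset.sum_range_succ _ (m + 1)]; push_cast; ring
      rw [e]
      refine (norm_add_le _ _).trans ?_
      rw [norm_mul, Complex.norm_real, Real.norm_eq_abs, abs_of_nonneg (by linarith [hw m])]
      have := mul_le_mul_of_nonneg_left (hB (m + 1) (by omega))
        (by linarith [hw m] : 0 ≤ w m - w (m + 1))
      linarith
  have h1 := key N le_rfl
  have h2 : ‖(w N : ℂ) * ∑ n ∈ range (N + 1), z n‖ ≤ w N * B := by
    rw [norm_mul, Complex.norm_real, Real.norm_eq_abs, abs_of_nonneg (hw0 N)]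
    exact mul_le_mul_of_nonneg_left (hB _ le_rfl) (hw0 N)
  have h3 := norm_add_le (∑ n ∈ range (N + 1), (w n : ℂ) * z n
      - w N * ∑ n ∈ range (N + 1), z n) ((w N : ℂ) * ∑ n ∈ range (N + 1), z n)
  rw [sub_add_cancel] at h3
  linarith

/-- The correlation `∑ z (n + h) * conj (z n)` of a finite sequence. -/
noncomputable def correlation (z : ℕ → ℂ) (N h : ℕ) : ℂ :=
  ∑ n ∈ range (N - h), z (n + h) * conj (z n)

/-- The sequence `z` on `[0, N)` translated to start at `a` and extended by zero. -/
noncomputable def zeroExtend (z : ℕ → ℂ) (N a m : ℕ) : ℂ :=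
  if a ≤ m ∧ m < a + N then z (m - a) else 0

theorem sum_zeroExtend (z : ℕ → ℂ) {N H a : ℕ} (ha : a ≤ H) :
    ∑ m ∈ range (N + H), zeroExtend z N a m = ∑ n ∈ range N, z n := by
  have : ∑ m ∈ range (N + H), zeroExtend z N a m = ∑ m ∈ Ico a (a + N), z (m - a) := by
    symm
    refine Finset.sum_subset_zero_on_sdiff (fun m hm => ?_) (fun m hm => ?_) (fun m hm => ?_)
    · simp only [mem_Ico, mem_range] at *; omega
    · simp only [Finset.mem_sdiff, Finset.mem_Ico, Finset.mem_range] at hm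
      simp only [zeroExtend]
      rw [if_neg (by omega)]
    · simp only [mem_Ico] at hm
      simp only [zeroExtend]
      rw [if_pos (by omega)]
  rw [this, Finset.sum_Ico_eq_sum_range]
  simp

/-- Extension by zero lets all shifted copies be summed over one common range, where the product of
two copies depends only on the difference of the shifts. -/
theorem sum_zeroExtend_mul_conj (z : ℕ → ℂ) {N H a b : ℕ} (hab : a ≤ b) (hb : b ≤ H) :
    ∑ m ∈ range (N + H), zeroExtend z N a m * conj (zeroExtend z N b m)
      = correlation z N (b - a) := by
  have : ∑ m ∈ range (N + H), zeroExtend z N a m * conj (zeroExtend z N b m)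
      = ∑ m ∈ Ico b (a + N), z (m - a) * conj (z (m - b)) := by
    symm
    refine Finset.sum_subset_zero_on_sdiff (fun m hm => ?_) (fun m hm => ?_) (fun m hm => ?_)
    · simp only [mem_Ico, mem_range] at *; omega
    · simp only [Finset.mem_sdiff, Finset.mem_Ico, Finset.mem_range] at hm
      simp only [zeroExtend]
      by_cases h : a ≤ m ∧ m < a + N
      · rw [if_neg (by omega : ¬(b ≤ m ∧ m < b + N))]; simp
      · rw [if_neg h]; simp
    · simp only [mem_Ico] at hm
      simp only [zeroExtend]
      rw [if_pos (by omega), if_pos (by omega)]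
  rw [this, Finset.sum_Ico_eq_sum_range, correlation]
  have e : a + N - b = N - (b - a) := by omega
  rw [e]
  refine Finset.sum_congr rfl fun n _ => ?_
  have e1 : b + n - a = n + (b - a) := by omega
  have e2 : b + n - b = n := by omega
  rw [e1, e2]

theorem norm_sum_zeroExtend_mul_conj_le (z : ℕ → ℂ) {N H a b : ℕ} (ha : a < H) (hb : b < H) :
    ‖∑ m ∈ range (N + H), zeroExtend z N a m * conj (zeroExtend z N b m)‖
      ≤ ∑ h ∈ range H, ((if b + h = a then ‖correlation z N h‖ else 0)
        + (if a + h = b then ‖correlation z N h‖ else 0)) := by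
  rw [Finset.sum_add_distrib]
  have hnn1 : 0 ≤ ∑ h ∈ range H, (if b + h = a then ‖correlation z N h‖ else 0) :=
    Finset.sum_nonneg fun h _ => by split_ifs <;> positivity
  have hnn2 : 0 ≤ ∑ h ∈ range H, (if a + h = b then ‖correlation z N h‖ else 0) :=
    Finset.sum_nonneg fun h _ => by split_ifs <;> positivity
  rcases le_total a b with hab | hab
  · rw [sum_zeroExtend_mul_conj z hab hb.le]
    have := Finset.single_le_sum
      (f := fun h => if a + h = b then ‖correlation z N h‖ else 0)
      (fun h _ => by split_ifs <;> positivity) (mem_range.mpr (by omega : b - a < H))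
    simp only [Nat.add_sub_cancel' hab, if_true] at this
    linarith
  · have e : ∑ m ∈ range (N + H), zeroExtend z N a m * conj (zeroExtend z N b m)
        = conj (∑ m ∈ range (N + H), zeroExtend z N b m * conj (zeroExtend z N a m)) := by
      rw [map_sum]
      refine Finset.sum_congr rfl fun m _ => ?_
      simp [mul_comm]
    rw [e, RCLike.norm_conj, sum_zeroExtend_mul_conj z hab ha.le]
    have := Finset.single_le_sum
      (f := fun h => if b + h = a then ‖correlation z N h‖ else 0)
      (fun h _ => by split_ifs <;> positivity) (mem_range.mpr (by omega : a - b < H))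
    simp only [Nat.add_sub_cancel' hab, if_true] at this
    linarith

/-- The van der Corput differencing inequality. -/
theorem mul_norm_sum_sq_le_sum_correlation (z : ℕ → ℂ) (N H : ℕ) :
    H * ‖∑ n ∈ range N, z n‖ ^ 2 ≤ 2 * (N + H) * ∑ h ∈ range H, ‖correlation z N h‖ := by
  rcases Nat.eq_zero_or_pos H with rfl | hH
  · simp
  set S := ∑ n ∈ range N, z n with hS
  set Y : ℕ → ℂ := fun m => ∑ a ∈ range H, zeroExtend z N a m with hY
  have h1 : (H : ℂ) * S = ∑ m ∈ range (N + H), Y m := by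
    simp only [hY]
    rw [Finset.sum_comm]
    rw [Finset.sum_congr rfl fun a ha => sum_zeroExtend z (mem_range.mp ha).le]
    simp [hS]
  -- Cauchy–Schwarz over the N + H positions m.
  have h2 : (H * ‖S‖) ^ 2 ≤ (N + H) * ∑ m ∈ range (N + H), ‖Y m‖ ^ 2 := by
    have e : (H : ℝ) * ‖S‖ = ‖∑ m ∈ range (N + H), Y m‖ := by rw [← h1, norm_mul]; simp
    rw [e]
    refine (pow_le_pow_left₀ (norm_nonneg _) (norm_sum_le _ _) 2).trans ?_
    refine sq_sum_le_card_mul_sum_sq.trans_eq ?_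
    simp
  have h3 : ((∑ m ∈ range (N + H), ‖Y m‖ ^ 2 : ℝ) : ℂ) = ∑ a ∈ range H, ∑ b ∈ range H,
      ∑ m ∈ range (N + H), zeroExtend z N a m * conj (zeroExtend z N b m) := by
    push_cast
    have e : ∀ m ∈ range (N + H), ((‖Y m‖ : ℂ)) ^ 2 = ∑ a ∈ range H, ∑ b ∈ range H,
        zeroExtend z N a m * conj (zeroExtend z N b m) := by
      intro m _
      rw [← Complex.mul_conj', hY, map_sum, Finset.sum_mul_sum]
    rw [Finset.sum_congr rfl e, Finset.sum_comm]
    refine Finset.sum_congr rfl fun a _ => ?_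
    rw [Finset.sum_comm]
  have h4 : ∑ m ∈ range (N + H), ‖Y m‖ ^ 2 ≤ H * (2 * ∑ h ∈ range H, ‖correlation z N h‖) := by
    have hnn : 0 ≤ ∑ m ∈ range (N + H), ‖Y m‖ ^ 2 := Finset.sum_nonneg fun _ _ => by positivity
    have e : ∑ m ∈ range (N + H), ‖Y m‖ ^ 2 = ‖((∑ m ∈ range (N + H), ‖Y m‖ ^ 2 : ℝ) : ℂ)‖ := by
      rw [Complex.norm_real, Real.norm_of_nonneg hnn]
    rw [e, h3]
    refine (norm_sum_le _ _).trans ?_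
    -- For fixed a, each h arises from at most the two shifts b = a - h and b = a + h.
    have hrow : ∀ a ∈ range H, ‖∑ b ∈ range H, ∑ m ∈ range (N + H),
        zeroExtend z N a m * conj (zeroExtend z N b m)‖ ≤ 2 * ∑ h ∈ range H, ‖correlation z N h‖ := by
      intro a ha
      refine (norm_sum_le _ _).trans ?_
      refine (Finset.sum_le_sum fun b hb =>
        norm_sum_zeroExtend_mul_conj_le z (mem_range.mp ha) (mem_range.mp hb)).trans ?_
      rw [Finset.sum_comm, Finset.mul_sum]
      refine Finset.sum_le_sum fun h _ => ?_
      rw [Finset.sum_add_distrib, two_mul]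
      refine add_le_add ?_ ?_
      · by_cases hh : h ≤ a
        · have : ∀ b, (b + h = a) = (b = a - h) := fun b => by
            apply propext; omega
          simp only [this, Finset.sum_ite_eq']
          split_ifs <;> simp
        · rw [Finset.sum_eq_zero fun b _ => if_neg (by omega)]
          exact norm_nonneg _
      · rw [Finset.sum_ite_eq]
        split_ifs <;> simp
    refine (Finset.sum_le_sum hrow).trans_eq ?_
    simp
  have hHpos : (0 : ℝ) < H := by exact_mod_cast hH
  have h5 : H * (H * ‖S‖ ^ 2) ≤ H * (2 * (N + H) * ∑ h ∈ range H, ‖correlation z N h‖) := by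
    calc H * (H * ‖S‖ ^ 2) = (H * ‖S‖) ^ 2 := by ring
      _ ≤ _ := h2
      _ ≤ (N + H) * (H * (2 * ∑ h ∈ range H, ‖correlation z N h‖)) := by gcongr
      _ = _ := by ring
  exact le_of_mul_le_mul_left h5 hHpos

/-! ### Truncation of the zeta series in the half-plane re s > 0. -/

/-- `(s - 1)` times the difference of `n ^ (-s)` and `∫ x in n..n+1, x ^ (-s)`, for `n = i + 1`. -/
noncomputable def zetaTerm (i : ℕ) (s : ℂ) : ℂ :=
  (s - 1) * ((i + 1 : ℕ) : ℂ) ^ (-s)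
    - (((i + 1 : ℕ) : ℂ) ^ (1 - s) - ((i + 2 : ℕ) : ℂ) ^ (1 - s))

theorem norm_cpow_neg_sub_le {s : ℂ} (hs : 0 < s.re) {a x : ℝ} (ha : 0 < a) (hax : a ≤ x)
    (hx : x ≤ a + 1) :
    ‖(a : ℂ) ^ (-s) - (x : ℂ) ^ (-s)‖ ≤ ‖s‖ * a ^ (-s.re - 1) := by
  have hderiv : ∀ y ∈ Set.Icc a x, HasDerivWithinAt (fun y : ℝ => (y : ℂ) ^ (-s))
      (-s * (y : ℂ) ^ (-s - 1)) (Set.Icc a x) y := by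
    intro y hy
    have hy0 : 0 < y := lt_of_lt_of_le ha hy.1
    have hs0 : -s ≠ 0 := by
      intro h; rw [neg_eq_zero] at h; rw [h] at hs; simp at hs
    exact (hasDerivAt_ofReal_cpow_const hy0.ne' hs0).hasDerivWithinAt
  have hbd : ∀ y ∈ Set.Icc a x, ‖-s * (y : ℂ) ^ (-s - 1)‖ ≤ ‖s‖ * a ^ (-s.re - 1) := by
    intro y hy
    have hy0 : 0 < y := lt_of_lt_of_le ha hy.1
    rw [norm_mul, norm_neg, norm_cpow_eq_rpow_re_of_pos hy0]
    simp only [sub_re, neg_re, one_re]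
    gcongr ‖s‖ * ?_
    exact Real.rpow_le_rpow_of_nonpos ha hy.1 (by linarith)
  have := (convex_Icc a x).norm_image_sub_le_of_norm_hasDerivWithin_le hderiv hbd
    (Set.right_mem_Icc.mpr hax) (Set.left_mem_Icc.mpr hax)
  refine this.trans ?_
  rw [Real.norm_eq_abs, abs_of_nonpos (by linarith)]
  have h1 : -(a - x) ≤ 1 := by linarith
  exact mul_le_of_le_one_right (by positivity) h1

/-- The integrand is a difference of nearby values of x^(-s), which gains a factor |s|/x and yields
summability for all re s > 0. -/
theorem zetaTerm_eq_integral {s : ℂ} (hs1 : s ≠ 1) (i : ℕ) :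
    zetaTerm i s = (s - 1) * ∫ x in ((i + 1 : ℕ) : ℝ)..((i + 1 : ℕ) : ℝ) + 1,
      ((((i + 1 : ℕ) : ℝ) : ℂ) ^ (-s) - (x : ℂ) ^ (-s)) := by
  have h0 : (0 : ℝ) ∉ Set.uIcc ((i + 1 : ℕ) : ℝ) (((i + 1 : ℕ) : ℝ) + 1) := by
    rw [Set.uIcc_of_le (by linarith)]
    intro h
    have := h.1
    have : (0 : ℝ) < ((i + 1 : ℕ) : ℝ) := by positivity
    linarith
  have hcond : -1 < (-s).re ∨ -s ≠ -1 ∧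
      (0 : ℝ) ∉ Set.uIcc ((i + 1 : ℕ) : ℝ) (((i + 1 : ℕ) : ℝ) + 1) :=
    Or.inr ⟨fun h => hs1 (neg_inj.mp h), h0⟩
  rw [intervalIntegral.integral_sub (by simp)
    (intervalIntegral.intervalIntegrable_cpow (Or.inr h0)),
    integral_cpow hcond]
  have hs1' : s - 1 ≠ 0 := sub_ne_zero.mpr hs1
  have hs2 : -s + 1 ≠ 0 := by
    intro h; apply hs1'; linear_combination -h
  simp only [intervalIntegral.integral_const, add_sub_cancel_left, one_smul, zetaTerm]
  have e : (1 : ℂ) - s = -s + 1 := by ring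
  rw [e]
  push_cast
  field_simp
  ring_nf

theorem norm_zetaTerm_le {s : ℂ} (hs : 0 < s.re) (i : ℕ) :
    ‖zetaTerm i s‖ ≤ ‖s - 1‖ * (‖s‖ * ((i + 1 : ℕ) : ℝ) ^ (-s.re - 1)) := by
  by_cases hs1 : s = 1
  · subst hs1; simp [zetaTerm]
  rw [zetaTerm_eq_integral hs1, norm_mul]
  gcongr
  have h := intervalIntegral.norm_integral_le_of_norm_le_const
    (a := ((i + 1 : ℕ) : ℝ)) (b := ((i + 1 : ℕ) : ℝ) + 1)
    (f := fun x : ℝ => ((((i + 1 : ℕ) : ℝ) : ℂ) ^ (-s) - (x : ℂ) ^ (-s)))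
    (C := ‖s‖ * ((i + 1 : ℕ) : ℝ) ^ (-s.re - 1)) ?_
  · simpa using h
  · intro x hx
    rw [Set.uIoc_of_le (by linarith)] at hx
    exact norm_cpow_neg_sub_le hs (by positivity) hx.1.le hx.2

theorem summable_succ_rpow {σ : ℝ} (hσ : 0 < σ) :
    Summable fun i : ℕ => ((i + 1 : ℕ) : ℝ) ^ (-σ - 1) := by
  have := (Real.summable_nat_rpow (p := -σ - 1)).mpr (by linarith)
  exact (summable_nat_add_iff 1).mpr this

theorem summable_zetaTerm {s : ℂ} (hs : 0 < s.re) : Summable fun i => zetaTerm i s := by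
  refine Summable.of_norm_bounded (g := fun i : ℕ =>
    ‖s - 1‖ * (‖s‖ * ((i + 1 : ℕ) : ℝ) ^ (-s.re - 1))) ?_ fun i => norm_zetaTerm_le hs i
  exact ((summable_succ_rpow hs).mul_left _).mul_left _

theorem differentiable_zetaTerm (i : ℕ) : Differentiable ℂ (zetaTerm i) := by
  have h1 : ((i + 1 : ℕ) : ℂ) ≠ 0 := by exact_mod_cast Nat.succ_ne_zero i
  have h2 : ((i + 2 : ℕ) : ℂ) ≠ 0 := by exact_mod_cast Nat.succ_ne_zero (i + 1)
  intro s
  unfold zetaTerm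
  refine DifferentiableAt.sub (DifferentiableAt.mul (by fun_prop) ?_) (DifferentiableAt.sub ?_ ?_)
  · exact DifferentiableAt.const_cpow (by fun_prop) (Or.inl h1)
  · exact DifferentiableAt.const_cpow (by fun_prop) (Or.inl h1)
  · exact DifferentiableAt.const_cpow (by fun_prop) (Or.inl h2)

theorem differentiableOn_tsum_zetaTerm :
    DifferentiableOn ℂ (fun s => ∑' i, zetaTerm i s) {s : ℂ | 0 < s.re} := by
  intro s hs
  simp only [Set.mem_ofPred_eq] at hs
  set U : Set ℂ := {w : ℂ | s.re / 2 < w.re} ∩ Metric.ball 0 (‖s‖ + 1) with hU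
  have hUo : IsOpen U :=
    (isOpen_lt continuous_const Complex.continuous_re).inter Metric.isOpen_ball
  have hsU : s ∈ U := ⟨by simp only [Set.mem_ofPred_eq]; linarith, by simp⟩
  have h := differentiableOn_tsum_of_summable_norm (F := zetaTerm) (U := U)
    (u := fun i : ℕ => (‖s‖ + 2) * ((‖s‖ + 1) * ((i + 1 : ℕ) : ℝ) ^ (-(s.re / 2) - 1)))
    (((summable_succ_rpow (by linarith)).mul_left _).mul_left _)
    (fun i => (differentiable_zetaTerm i).differentiableOn) hUo ?_
  · exact ((h s hsU).differentiableAt (hUo.mem_nhds hsU)).differentiableWithinAt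
  · intro i w hw
    have hw1 : s.re / 2 < w.re := hw.1
    have hw2 : ‖w‖ < ‖s‖ + 1 := by simpa using hw.2
    refine (norm_zetaTerm_le (by linarith) i).trans ?_
    have h3 : ‖w - 1‖ ≤ ‖s‖ + 2 := by
      have := norm_sub_le w 1
      rw [norm_one] at this
      linarith
    have h4 : ((i + 1 : ℕ) : ℝ) ^ (-w.re - 1) ≤ ((i + 1 : ℕ) : ℝ) ^ (-(s.re / 2) - 1) :=
      Real.rpow_le_rpow_of_exponent_le (by simp) (by linarith)
    gcongr

theorem sum_range_zetaTerm (K : ℕ) (s : ℂ) :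
    ∑ i ∈ range K, zetaTerm i s
      = (s - 1) * ∑ i ∈ range K, ((i + 1 : ℕ) : ℂ) ^ (-s) - 1 + ((K + 1 : ℕ) : ℂ) ^ (1 - s) := by
  induction K with
  | zero => simp
  | succ K ih =>
    rw [Finset.sum_range_succ, ih, Finset.sum_range_succ, zetaTerm]
    ring

theorem riemannZeta₁_eq_sub_one_mul {s : ℂ} (hs : s ≠ 1) :
    riemannZeta₁ s = (s - 1) * riemannZeta s := by
  rw [riemannZeta_eq_inv_sub_mul hs]
  have : s - 1 ≠ 0 := sub_ne_zero.mpr hs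
  field_simp

theorem riemannZeta₁_eq_tsum_of_one_lt_re {s : ℂ} (hs : 1 < s.re) :
    riemannZeta₁ s = 1 + ∑' i, zetaTerm i s := by
  have hs1 : s ≠ 1 := by rintro rfl; simp at hs
  have h1 := (summable_zetaTerm (by linarith : 0 < s.re)).hasSum.tendsto_sum_nat
  have hz : HasSum (fun i : ℕ => ((i + 1 : ℕ) : ℂ) ^ (-s)) (riemannZeta s) := by
    have hsum := (summable_nat_add_iff 1).mpr (Complex.summable_one_div_nat_cpow.mpr hs)
    have := hsum.hasSum
    rw [zeta_eq_tsum_one_div_nat_add_one_cpow hs]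
    simpa [Complex.cpow_neg] using this
  have h2 : Filter.Tendsto (fun K : ℕ => ((K + 1 : ℕ) : ℂ) ^ (1 - s)) Filter.atTop (nhds 0) := by
    rw [tendsto_zero_iff_norm_tendsto_zero]
    have e : ∀ K : ℕ, ‖((K + 1 : ℕ) : ℂ) ^ (1 - s)‖ = ((K + 1 : ℕ) : ℝ) ^ (-(s.re - 1)) := by
      intro K
      rw [Complex.norm_natCast_cpow_of_pos (by omega)]
      simp
    simp only [e]
    exact ((tendsto_rpow_neg_atTop (by linarith)).comp tendsto_natCast_atTop_atTop).comp
      (Filter.tendsto_add_atTop_nat 1)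
  have h3 := ((hz.tendsto_sum_nat.const_mul (s - 1)).sub_const 1).add h2
  have e : (fun K : ℕ => ∑ i ∈ range K, zetaTerm i s) = fun K : ℕ =>
      (s - 1) * ∑ i ∈ range K, ((i + 1 : ℕ) : ℂ) ^ (-s) - 1 + ((K + 1 : ℕ) : ℂ) ^ (1 - s) :=
    funext fun K => sum_range_zetaTerm K s
  rw [e] at h1
  have := tendsto_nhds_unique h1 h3
  rw [this, riemannZeta₁_eq_sub_one_mul hs1]
  ring

/-- Both sides are analytic on the half-plane and agree near 2, where telescoping and the Dirichlet
series apply; the identity theorem does the rest. -/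
theorem riemannZeta₁_eq_tsum {s : ℂ} (hs : 0 < s.re) :
    riemannZeta₁ s = 1 + ∑' i, zetaTerm i s := by
  have hopen : IsOpen {s : ℂ | 0 < s.re} := isOpen_lt continuous_const Complex.continuous_re
  have h1 : AnalyticOnNhd ℂ riemannZeta₁ {s : ℂ | 0 < s.re} :=
    differentiable_riemannZeta₁.differentiableOn.analyticOnNhd hopen
  have h2 : AnalyticOnNhd ℂ (fun s => 1 + ∑' i, zetaTerm i s) {s : ℂ | 0 < s.re} :=
    (differentiableOn_tsum_zetaTerm.const_add 1).analyticOnNhd hopen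
  have hpre : IsPreconnected {s : ℂ | 0 < s.re} :=
    (convex_halfSpace_re_gt 0).isPreconnected
  refine h1.eqOn_of_preconnected_of_eventuallyEq h2 hpre (z₀ := 2) (by simp) ?_ hs
  have : {s : ℂ | 1 < s.re} ∈ nhds (2 : ℂ) :=
    (isOpen_lt continuous_const Complex.continuous_re).mem_nhds (by simp)
  filter_upwards [this] with s hs
  exact riemannZeta₁_eq_tsum_of_one_lt_re hs

/-- Truncation of the zeta series in the half-plane `0 < re s`. -/
theorem riemannZeta_eq_sum_add {s : ℂ} (hs : 0 < s.re) (hs1 : s ≠ 1) (K : ℕ) :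
    riemannZeta s = ∑ i ∈ range K, ((i + 1 : ℕ) : ℂ) ^ (-s)
      + ((K + 1 : ℕ) : ℂ) ^ (1 - s) / (s - 1) + (∑' i, zetaTerm (i + K) s) / (s - 1) := by
  have h := riemannZeta₁_eq_tsum hs
  rw [riemannZeta₁_eq_sub_one_mul hs1,
    ← (summable_zetaTerm hs).sum_add_tsum_nat_add K, sum_range_zetaTerm] at h
  have : s - 1 ≠ 0 := sub_ne_zero.mpr hs1
  field_simp
  linear_combination h

theorem norm_riemannZeta_sub_le {s : ℂ} (hs : 0 < s.re) (hs1 : s ≠ 1) (K : ℕ) :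
    ‖riemannZeta s - ∑ i ∈ range K, ((i + 1 : ℕ) : ℂ) ^ (-s)‖
      ≤ ((K + 1 : ℕ) : ℝ) ^ (1 - s.re) / ‖s - 1‖
        + ‖s‖ * ∑' i : ℕ, ((i + K + 1 : ℕ) : ℝ) ^ (-s.re - 1) := by
  have hs1' : 0 < ‖s - 1‖ := norm_pos_iff.mpr (sub_ne_zero.mpr hs1)
  rw [riemannZeta_eq_sum_add hs hs1 K, add_assoc, add_sub_cancel_left]
  refine (norm_add_le _ _).trans (add_le_add ?_ ?_)
  · rw [norm_div, Complex.norm_natCast_cpow_of_pos (by omega)]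
    simp
  · rw [norm_div, div_le_iff₀ hs1']
    have hsum := (summable_nat_add_iff K).mpr (summable_succ_rpow hs)
    have hsum2 := (hsum.mul_left ‖s‖).mul_left ‖s - 1‖
    refine (tsum_of_norm_bounded hsum2.hasSum fun i => norm_zetaTerm_le hs (i + K)).trans_eq ?_
    rw [tsum_mul_left, tsum_mul_left]
    ring

/-- Comparison with the telescoping difference 1/√n - 1/√(n+1), using √(n+1) ≤ (3/2)√n. -/
theorem rpow_neg_three_halves_le {n : ℕ} (hn : 0 < n) :
    (n : ℝ) ^ (-(1 / 2 : ℝ) - 1) ≤ 4 * (1 / √n - 1 / √(n + 1 : ℕ)) := by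
  have hn' : (0 : ℝ) < n := by exact_mod_cast hn
  have hn1 : (1 : ℝ) ≤ n := by exact_mod_cast hn
  set a := √(n : ℝ) with ha
  set b := √((n + 1 : ℕ) : ℝ) with hb
  have ha0 : 0 < a := Real.sqrt_pos.mpr hn'
  have hb0 : 0 < b := Real.sqrt_pos.mpr (by positivity)
  have ha2 : a ^ 2 = n := Real.sq_sqrt hn'.le
  have hb2 : b ^ 2 = n + 1 := by rw [hb, Real.sq_sqrt (by positivity)]; push_cast; ring
  have e : (n : ℝ) ^ (-(1 / 2 : ℝ) - 1) = 1 / a ^ 3 := by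
    rw [ha, Real.sqrt_eq_rpow, ← Real.rpow_natCast, ← Real.rpow_mul hn'.le,
      ← Real.rpow_zero (n : ℝ), ← Real.rpow_sub hn']
    norm_num
  have hbn : b ≤ 3 / 2 * a := by
    refine (sq_le_sq₀ hb0.le (by positivity)).mp ?_
    nlinarith
  have e2 : 1 / a - 1 / b = 1 / (a * b * (a + b)) := by
    field_simp
    nlinarith
  rw [e, e2, mul_one_div, div_le_div_iff₀ (by positivity) (by positivity), one_mul]
  have h1 : a * b * (a + b) ≤ a * (3 / 2 * a) * (a + 3 / 2 * a) := by gcongr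
  nlinarith [pow_pos ha0 3]

theorem tsum_rpow_neg_three_halves_le (K : ℕ) :
    ∑' i : ℕ, ((i + K + 1 : ℕ) : ℝ) ^ (-(1 / 2 : ℝ) - 1) ≤ 4 / √(K + 1 : ℕ) := by
  refine Real.tsum_le_of_sum_range_le (fun i => by positivity) fun n => ?_
  have : ∀ i ∈ range n, ((i + K + 1 : ℕ) : ℝ) ^ (-(1 / 2 : ℝ) - 1)
      ≤ 4 * (1 / √(i + K + 1 : ℕ) - 1 / √((i + 1) + K + 1 : ℕ)) := fun i _ => by
    have := rpow_neg_three_halves_le (n := i + K + 1) (by omega)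
    rwa [show i + K + 1 + 1 = i + 1 + K + 1 by ring] at this
  refine (Finset.sum_le_sum this).trans ?_
  rw [← Finset.mul_sum, Finset.sum_range_sub' (fun i => 1 / √((i + K + 1 : ℕ) : ℝ))]
  have : 0 ≤ 1 / √((n + K + 1 : ℕ) : ℝ) := by positivity
  have e : 4 / √((K + 1 : ℕ) : ℝ) = 4 * (1 / √((K + 1 : ℕ) : ℝ)) := by ring
  rw [e, zero_add]
  linarith

/-- The truncation with no terms. This crude bound supplies the a priori growth and the outer
boundary values for the convexity argument. -/
theorem exists_norm_riemannZeta_le_linear : ∃ C : ℝ, 0 < C ∧ ∀ s : ℂ, 1 / 4 ≤ s.re → s.re ≤ 3 / 4 →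
    ‖riemannZeta s‖ ≤ C * (1 + |s.im|) := by
  set S := ∑' i : ℕ, ((i + 1 : ℕ) : ℝ) ^ (-(1 / 4 : ℝ) - 1) with hS
  have hsum4 := summable_succ_rpow (by norm_num : (0 : ℝ) < 1 / 4)
  have hS0 : 0 ≤ S := tsum_nonneg fun i => by positivity
  refine ⟨4 + S, by positivity, fun s h1 h2 => ?_⟩
  have hs1 : s ≠ 1 := by rintro rfl; norm_num at h2
  have h := norm_riemannZeta_sub_le (by linarith : 0 < s.re) hs1 0
  simp only [range_zero, sum_empty, sub_zero, zero_add, Nat.cast_one, Real.one_rpow,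
    add_zero] at h
  have h3 : 1 / 4 ≤ ‖s - 1‖ := by
    have := Complex.abs_re_le_norm (s - 1)
    rw [sub_re, one_re, abs_of_nonpos (by linarith)] at this
    linarith
  have h4 : 1 / ‖s - 1‖ ≤ 4 := by
    rw [div_le_iff₀ (by linarith)]; linarith
  have h5 : ‖s‖ ≤ 1 + |s.im| := by
    have := Complex.norm_le_abs_re_add_abs_im s
    rw [abs_of_nonneg (by linarith)] at this
    linarith
  have h6 : ∑' i : ℕ, ((i + 1 : ℕ) : ℝ) ^ (-s.re - 1) ≤ S := by
    refine Summable.tsum_le_tsum (fun i => ?_) (summable_succ_rpow (by linarith)) hsum4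
    exact Real.rpow_le_rpow_of_exponent_le (by simp) (by linarith)
  have h7 : ‖s‖ * ∑' i : ℕ, ((i + 1 : ℕ) : ℝ) ^ (-s.re - 1) ≤ (1 + |s.im|) * S :=
    mul_le_mul h5 h6 (tsum_nonneg fun i => by positivity) (by positivity)
  nlinarith [abs_nonneg s.im]

/-! ### Exponential sums with phase -t log n over blocks of length at most M. -/

/-- The phase `-t log (M + n)` of `(M + n) ^ (-it)`. -/
noncomputable def logPhase (t : ℝ) (M n : ℕ) : ℝ := -(t * Real.log (M + n))

theorem log_succ_sub_log_bounds {x : ℝ} (hx : 0 < x) :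
    1 / (x + 1) ≤ Real.log (x + 1) - Real.log x ∧ Real.log (x + 1) - Real.log x ≤ 1 / x := by
  rw [← Real.log_div (by positivity) (by positivity)]
  constructor
  · refine le_trans (le_of_eq ?_) (Real.one_sub_inv_le_log_of_pos (by positivity))
    field_simp; ring
  · refine (Real.log_le_sub_one_of_pos (by positivity)).trans (le_of_eq ?_)
    field_simp; ring

/-- Minus the second difference of the logarithm. -/
noncomputable def logSecondDiff (x : ℝ) : ℝ :=
  2 * Real.log (x + 1) - Real.log x - Real.log (x + 2)

/-- The quantity is log(1 + 1/(x(x+2))), so 1 - 1/y ≤ log y ≤ y - 1 suffices. -/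
theorem logSecondDiff_bounds {x : ℝ} (hx : 0 < x) :
    1 / (x + 1) ^ 2 ≤ logSecondDiff x ∧ logSecondDiff x ≤ 1 / x ^ 2 := by
  have e : logSecondDiff x = Real.log ((x + 1) ^ 2 / (x * (x + 2))) := by
    rw [Real.log_div (by positivity) (by positivity), Real.log_mul (by positivity) (by positivity),
      Real.log_pow, logSecondDiff]
    push_cast; ring
  rw [e]
  constructor
  · refine le_trans (le_of_eq ?_) (Real.one_sub_inv_le_log_of_pos (by positivity))
    field_simp; ring
  · refine (Real.log_le_sub_one_of_pos (by positivity)).trans ?_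
    have e2 : (x + 1) ^ 2 / (x * (x + 2)) - 1 = 1 / (x * (x + 2)) := by field_simp; ring
    rw [e2]
    gcongr
    nlinarith

theorem logSecondDiff_sub_bounds {x : ℝ} (hx : 0 < x) :
    1 / (x + 1) ^ 3 ≤ logSecondDiff x - logSecondDiff (x + 1) ∧
      logSecondDiff x - logSecondDiff (x + 1) ≤ 2 / x ^ 3 := by
  have e : logSecondDiff x - logSecondDiff (x + 1)
      = Real.log ((x + 1) ^ 3 * (x + 3) / (x * (x + 2) ^ 3)) := by
    rw [Real.log_div (by positivity) (by positivity), Real.log_mul (by positivity) (by positivity),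
      Real.log_mul (by positivity) (by positivity), Real.log_pow, Real.log_pow, logSecondDiff,
      logSecondDiff, show x + 1 + 1 = x + 2 by ring, show x + 1 + 2 = x + 3 by ring]
    push_cast; ring
  rw [e]
  constructor
  · refine le_trans ?_ (Real.one_sub_inv_le_log_of_pos (by positivity))
    have e2 : 1 - ((x + 1) ^ 3 * (x + 3) / (x * (x + 2) ^ 3))⁻¹
        = (2 * x + 3) / ((x + 1) ^ 3 * (x + 3)) := by field_simp; ring
    rw [e2, div_le_div_iff₀ (by positivity) (by positivity)]
    nlinarith [pow_pos (by linarith : 0 < x + 1) 3]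
  · refine (Real.log_le_sub_one_of_pos (by positivity)).trans ?_
    have e2 : (x + 1) ^ 3 * (x + 3) / (x * (x + 2) ^ 3) - 1
        = (2 * x + 3) / (x * (x + 2) ^ 3) := by field_simp; ring
    rw [e2, div_le_div_iff₀ (by positivity) (by positivity)]
    have : (2 * x + 3) * x ^ 2 ≤ 2 * (x + 2) ^ 3 := by nlinarith [sq_nonneg x]
    nlinarith

theorem logSecondDiff_sub_add_bounds {x Y : ℝ} (hx : 0 < x) (h : ℕ) (hY : x + h ≤ Y) :
    h / Y ^ 3 ≤ logSecondDiff x - logSecondDiff (x + h) ∧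
      logSecondDiff x - logSecondDiff (x + h) ≤ h * (2 / x ^ 3) := by
  induction h with
  | zero => simp
  | succ h ih =>
    push_cast at hY ⊢
    obtain ⟨i1, i2⟩ := ih (by linarith)
    obtain ⟨j1, j2⟩ := logSecondDiff_sub_bounds (x := x + h) (by positivity)
    have k1 : 1 / Y ^ 3 ≤ 1 / (x + h + 1) ^ 3 := by gcongr; linarith
    have k2 : 2 / (x + h) ^ 3 ≤ 2 / x ^ 3 := by
      gcongr; linarith [(Nat.cast_nonneg h : (0 : ℝ) ≤ h)]
    have e : ((h : ℝ) + 1) / Y ^ 3 = h / Y ^ 3 + 1 / Y ^ 3 := by ring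
    rw [e, ← add_assoc]
    constructor <;> linarith

theorem logPhase_second_diff (t : ℝ) (M n : ℕ) :
    (logPhase t M (n + 2) - logPhase t M (n + 1)) - (logPhase t M (n + 1) - logPhase t M n)
      = t * logSecondDiff (M + n) := by
  simp only [logPhase, logSecondDiff]
  push_cast
  rw [show (M : ℝ) + (n + 1) = M + n + 1 by ring, show (M : ℝ) + (n + 2) = M + n + 2 by ring]
  ring

/-- Here the increments lie in [-t/M, -t/(2M)] with t/M ≤ 1; adding 2π puts them in the
Kusmin–Landau range with δ = t/(2M). -/
theorem norm_sum_logPhase_le_of_large {t : ℝ} (ht : 0 < t) {M N : ℕ} (hNM : N ≤ M) (hM : t ≤ M) :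
    ‖∑ n ∈ range N, exp ((logPhase t M n : ℂ) * I)‖ ≤ 20 * M / t := by
  have hM0 : (0 : ℝ) < M := by linarith
  have hpi := Real.pi_gt_three
  have hdiff : ∀ n, logPhase t M (n + 1) - logPhase t M n
      = -(t * (Real.log (M + n + 1) - Real.log (M + n))) := fun n => by
    simp only [logPhase]; push_cast; rw [← add_assoc]; ring
  have hle1 : t / M ≤ 1 := by rw [div_le_one hM0]; exact hM
  have e0 : t / (2 * M) = t / M / 2 := by field_simp
  have h := norm_sum_exp_le_of_monotone_diff
    (fun n => logPhase t M n - 2 * Real.pi * (-1 : ℤ) * n) N (t / (2 * M)) (by positivity) ?_ ?_ ?_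
  · simp only [exp_sub_two_pi_mul] at h
    refine h.trans (le_of_eq ?_)
    field_simp; norm_num
  · intro n hn
    have h1 := logPhase_second_diff t M n
    have h2 := (logSecondDiff_bounds (x := M + n) (by positivity)).1
    have h3 : 0 ≤ t * logSecondDiff (M + n) := mul_nonneg ht.le (le_trans (by positivity) h2)
    push_cast
    linarith
  · intro n hn
    have h1 := hdiff n
    have h2 := (log_succ_sub_log_bounds (x := M + n) (by positivity)).2
    have h3 : 1 / ((M : ℝ) + n) ≤ 1 / M := by gcongr; linarith [(Nat.cast_nonneg n : (0 : ℝ) ≤ n)]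
    have h4 : t * (Real.log (M + n + 1) - Real.log (M + n)) ≤ t * (1 / M) := by gcongr; linarith
    rw [mul_one_div] at h4
    push_cast
    linarith
  · intro n hn
    have h1 := hdiff n
    have h2 := (log_succ_sub_log_bounds (x := M + n) (by positivity)).1
    have hn' : (n : ℝ) + 1 ≤ M := by exact_mod_cast (by omega : n + 1 ≤ M)
    have h3 : 1 / (2 * (M : ℝ)) ≤ 1 / (M + n + 1) := by gcongr; linarith
    have h4 : t * (1 / (2 * M)) ≤ t * (Real.log (M + n + 1) - Real.log (M + n)) := by
      gcongr; linarith
    rw [mul_one_div] at h4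
    push_cast
    linarith

theorem norm_sum_logPhase_le_of_second_diff {t : ℝ} (ht : 0 < t) {M N : ℕ} (hNM : N ≤ M)
    (hM : 0 < M) (htM : t ≤ 4 * (M : ℝ) ^ 2) :
    ‖∑ n ∈ range N, exp ((logPhase t M n : ℂ) * I)‖
      ≤ (N * (t / M ^ 2) + 2) * (14 / √(t / (4 * M ^ 2))) := by
  have hM0 : (0 : ℝ) < M := by exact_mod_cast hM
  refine norm_sum_exp_le_of_second_diff (logPhase t M) N (t / (4 * M ^ 2)) (t / M ^ 2)
    (by positivity) (by rw [div_le_one (by positivity)]; exact htM) ?_ ?_ (by positivity)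
  · intro n hn
    rw [logPhase_second_diff]
    have h2 := (logSecondDiff_bounds (x := M + n) (by positivity)).1
    have hn' : (n : ℝ) + 1 ≤ M := by exact_mod_cast (by omega : n + 1 ≤ M)
    have h3 : 1 / (4 * (M : ℝ) ^ 2) ≤ 1 / (M + n + 1) ^ 2 := by
      gcongr
      have : ((M : ℝ) + n + 1) ^ 2 ≤ (2 * M) ^ 2 := by gcongr; linarith
      linarith
    rw [← mul_one_div]
    gcongr
    linarith
  · intro n hn
    rw [logPhase_second_diff]
    have h2 := (logSecondDiff_bounds (x := M + n) (by positivity)).2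
    have h3 : 1 / ((M : ℝ) + n) ^ 2 ≤ 1 / M ^ 2 := by
      gcongr; linarith [(Nat.cast_nonneg n : (0 : ℝ) ≤ n)]
    rw [← mul_one_div t]
    gcongr
    linarith

/-- The correlation is again an exponential sum. Its phase is a difference at distance h, so its
second differences have size th/M³, and the second-difference test applies. -/
theorem norm_correlation_logPhase_le {t : ℝ} (ht : 0 < t) {M N h : ℕ} (hNM : N ≤ M)
    (hM : 0 < M) (hh : 0 < h) (hth : t * h ≤ 8 * (M : ℝ) ^ 3) :
    ‖correlation (fun n => exp ((logPhase t M n : ℂ) * I)) N h‖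
      ≤ (M * (2 * t * h / M ^ 3) + 2) * (14 / √(t * h / (8 * M ^ 3))) := by
  have hM0 : (0 : ℝ) < M := by exact_mod_cast hM
  have hh0 : (0 : ℝ) < h := by exact_mod_cast hh
  have e : correlation (fun n => exp ((logPhase t M n : ℂ) * I)) N h
      = conj (∑ n ∈ range (N - h), exp (((logPhase t M n - logPhase t M (n + h) : ℝ) : ℂ) * I)) := by
    rw [correlation, map_sum]
    refine Finset.sum_congr rfl fun n _ => ?_
    simp only [← Complex.exp_conj, ← Complex.exp_add]
    congr 1
    simp only [map_mul, conj_ofReal, conj_I]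
    push_cast
    ring
  rw [e, RCLike.norm_conj]
  have key : ∀ n, n + 1 < N - h → t * h / (8 * M ^ 3) ≤
      t * (logSecondDiff (M + n) - logSecondDiff (M + n + h)) ∧
      t * (logSecondDiff (M + n) - logSecondDiff (M + n + h)) ≤ 2 * t * h / M ^ 3 := by
    intro n hn
    have hn' : (M : ℝ) + n + h ≤ 2 * M := by
      exact_mod_cast (by omega : M + n + h ≤ 2 * M)
    obtain ⟨h1, h2⟩ := logSecondDiff_sub_add_bounds (x := M + n) (by positivity) h hn'
    constructor
    · calc t * h / (8 * M ^ 3) = t * (h / (2 * M) ^ 3) := by ring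
        _ ≤ _ := by gcongr
    · calc _ ≤ t * (h * (2 / (M + n) ^ 3)) := by gcongr
        _ ≤ t * (h * (2 / (M : ℝ) ^ 3)) := by
          gcongr; linarith [(Nat.cast_nonneg n : (0 : ℝ) ≤ n)]
        _ = _ := by ring
  have hsd : ∀ n, (logPhase t M (n + 2) - logPhase t M (n + 2 + h)
        - (logPhase t M (n + 1) - logPhase t M (n + 1 + h)))
      - ((logPhase t M (n + 1) - logPhase t M (n + 1 + h))
        - (logPhase t M n - logPhase t M (n + h)))
      = t * (logSecondDiff (M + n) - logSecondDiff (M + n + h)) := by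
    intro n
    have h1 := logPhase_second_diff t M n
    have h2 := logPhase_second_diff t M (n + h)
    push_cast at h2
    rw [← add_assoc] at h2
    rw [show n + 2 + h = n + h + 2 by ring, show n + 1 + h = n + h + 1 by ring, mul_sub, ← h1, ← h2]
    ring
  have hmain := norm_sum_exp_le_of_second_diff
    (fun n => logPhase t M n - logPhase t M (n + h)) (N - h) (t * h / (8 * M ^ 3))
    (2 * t * h / M ^ 3) (by positivity) (by rw [div_le_one (by positivity)]; exact hth)
    (fun n hn => by rw [hsd]; exact (key n hn).1) (fun n hn => by rw [hsd]; exact (key n hn).2)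
    (by positivity)
  refine hmain.trans ?_
  gcongr
  omega

theorem sum_one_div_sqrt_le (H : ℕ) : ∑ h ∈ range H, 1 / √((h + 1 : ℕ) : ℝ) ≤ 2 * √(H : ℝ) := by
  induction H with
  | zero => simp
  | succ H ih =>
    rw [Finset.sum_range_succ]
    have ha : 0 ≤ √(H : ℝ) := Real.sqrt_nonneg _
    have hb : 0 < √((H + 1 : ℕ) : ℝ) := Real.sqrt_pos.mpr (by positivity)
    have ha2 : √(H : ℝ) ^ 2 = H := Real.sq_sqrt (by positivity)
    have hb2 : √((H + 1 : ℕ) : ℝ) ^ 2 = H + 1 := by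
      rw [Real.sq_sqrt (by positivity)]; push_cast; ring
    have : 1 / √((H + 1 : ℕ) : ℝ) ≤ 2 * √((H + 1 : ℕ) : ℝ) - 2 * √(H : ℝ) := by
      rw [div_le_iff₀ hb]
      nlinarith [sq_nonneg (√((H + 1 : ℕ) : ℝ) - √(H : ℝ))]
    linarith

theorem norm_correlation_zero_le {z : ℕ → ℂ} (hz : ∀ n, ‖z n‖ = 1) (N : ℕ) :
    ‖correlation z N 0‖ ≤ N := by
  rw [correlation]
  refine (norm_sum_le _ _).trans ?_
  simp [hz]

theorem sum_norm_correlation_logPhase_le {u : ℝ} (hu : 1 ≤ u) {M N H : ℕ} (hNM : N ≤ M)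
    (hM : 0 < M) (hH : u ^ 6 * H ≤ 8 * (M : ℝ) ^ 3) :
    ∑ h ∈ range H, ‖correlation (fun n => exp ((logPhase (u ^ 6) M n : ℂ) * I)) N h‖
      ≤ √M ^ 2 + 80 * (u ^ 3 * √H ^ 3 / √M + 2 * (√M ^ 3 * √H / u ^ 3)) := by
  have hu0 : 0 < u := by linarith
  have hM0 : (0 : ℝ) < M := by exact_mod_cast hM
  set q := √(M : ℝ) with hq
  have hq0 : 0 < q := Real.sqrt_pos.mpr hM0
  have hq2 : q ^ 2 = M := Real.sq_sqrt hM0.le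
  rcases H with _ | H
  · simp; positivity
  have hw2 : √((H + 1 : ℕ) : ℝ) ^ 2 = H + 1 := by
    rw [Real.sq_sqrt (by positivity)]; push_cast; ring
  set w := √((H + 1 : ℕ) : ℝ) with hw
  have hw0 : 0 < w := Real.sqrt_pos.mpr (by positivity)
  rw [Finset.sum_range_succ']
  have h0 : ‖correlation (fun n => exp ((logPhase (u ^ 6) M n : ℂ) * I)) N 0‖ ≤ q ^ 2 := by
    rw [hq2]
    refine (norm_correlation_zero_le (fun n => by simp [Complex.norm_exp_ofReal_mul_I]) N).trans ?_
    exact_mod_cast hNM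
  have hterm : ∀ h ∈ range H,
      ‖correlation (fun n => exp ((logPhase (u ^ 6) M n : ℂ) * I)) N (h + 1)‖
        ≤ 80 * (u ^ 3 * w / q + q ^ 3 / u ^ 3 * (1 / √((h + 1 : ℕ) : ℝ))) := by
    intro h hh
    have hhH : h + 1 ≤ H + 1 := by have := mem_range.mp hh; omega
    have hhH' : ((h + 1 : ℕ) : ℝ) ≤ ((H + 1 : ℕ) : ℝ) := by exact_mod_cast hhH
    have h1 := norm_correlation_logPhase_le (t := u ^ 6) (by positivity) hNM hM (Nat.succ_pos h)
      ((mul_le_mul_of_nonneg_left hhH' (by positivity)).trans hH)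
    refine h1.trans ?_
    have hrw : √((h + 1 : ℕ) : ℝ) ≤ w := Real.sqrt_le_sqrt hhH'
    simp only [Nat.succ_eq_add_one] at *
    set r := √((h + 1 : ℕ) : ℝ) with hr
    have hr0 : 0 < r := Real.sqrt_pos.mpr (by positivity)
    have hr2 : r ^ 2 = ((h + 1 : ℕ) : ℝ) := Real.sq_sqrt (by positivity)
    have h8 : √(8 : ℝ) ≤ 20 / 7 := by
      rw [Real.sqrt_le_left (by norm_num)]; norm_num
    have h88 : √(8 : ℝ) ^ 2 = 8 := Real.sq_sqrt (by norm_num)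
    have h80 : 0 < √(8 : ℝ) := by positivity
    have e : √(u ^ 6 * ((h + 1 : ℕ) : ℝ) / (8 * M ^ 3)) = u ^ 3 * r / (√8 * q ^ 3) := by
      rw [Real.sqrt_eq_iff_eq_sq (by positivity) (by positivity), div_pow, mul_pow (√8),
        h88, mul_pow, hr2, ← hq2]
      ring
    rw [e, ← hr2, ← hq2]
    have e2 : (q ^ 2 * (2 * u ^ 6 * r ^ 2 / (q ^ 2) ^ 3) + 2) * (14 / (u ^ 3 * r / (√8 * q ^ 3)))
        = 28 * √8 * (u ^ 3 * r / q + q ^ 3 / u ^ 3 * (1 / r)) := by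
      field_simp
      ring
    rw [e2]
    have h28 : 28 * √(8 : ℝ) ≤ 80 := by linarith
    gcongr
  refine (add_le_add (Finset.sum_le_sum hterm) h0).trans ?_
  rw [← Finset.mul_sum, Finset.sum_add_distrib, ← Finset.mul_sum]
  simp only [sum_const, card_range, nsmul_eq_mul]
  have hs := sum_one_div_sqrt_le H
  have hHw : √(H : ℝ) ≤ w := Real.sqrt_le_sqrt (by push_cast; linarith)
  have h2 : q ^ 3 / u ^ 3 * ∑ h ∈ range H, 1 / √((h + 1 : ℕ) : ℝ) ≤ q ^ 3 / u ^ 3 * (2 * w) := by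
    gcongr; linarith
  have h3 : (H : ℝ) * (u ^ 3 * w / q) ≤ w ^ 2 * (u ^ 3 * w / q) := by
    gcongr; linarith
  have e3 : w ^ 2 * (u ^ 3 * w / q) = u ^ 3 * w ^ 3 / q := by ring
  have e4 : q ^ 3 / u ^ 3 * (2 * w) = 2 * (q ^ 3 * w / u ^ 3) := by ring
  linarith

theorem norm_sum_logPhase_le_of_mid {u : ℝ} (hu : 1 ≤ u) {M N : ℕ} (hNM : N ≤ M)
    (hM1 : u ^ 2 ≤ M) (hM2 : (M : ℝ) ≤ u ^ 4) :
    ‖∑ n ∈ range N, exp ((logPhase (u ^ 6) M n : ℂ) * I)‖ ≤ 100 * √M * u := by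
  have hu0 : 0 < u := by linarith
  have hM0 : (0 : ℝ) < M := lt_of_lt_of_le (by positivity) hM1
  have hM : 0 < M := by exact_mod_cast hM0
  -- With t = u⁶, this balances the diagonal contribution M²/H to |S|² against the contribution
  -- u³√(HM) of the other correlations; both become Mu².
  set H : ℕ := ⌈(M : ℝ) / u ^ 2⌉₊ with hHdef
  have hHlo : (M : ℝ) / u ^ 2 ≤ H := Nat.le_ceil _
  have h1M : 1 ≤ (M : ℝ) / u ^ 2 := by rwa [le_div_iff₀ (by positivity), one_mul]
  have hHhi : (H : ℝ) ≤ 2 * (M / u ^ 2) := by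
    have := (Nat.ceil_lt_add_one (by positivity : 0 ≤ (M : ℝ) / u ^ 2)).le
    linarith
  have hHM : H ≤ M := by
    refine Nat.ceil_le.mpr (div_le_self hM0.le (one_le_pow₀ hu))
  have hH0 : (0 : ℝ) < H := by linarith
  have hcond : u ^ 6 * H ≤ 8 * (M : ℝ) ^ 3 := by
    calc u ^ 6 * H ≤ u ^ 6 * (2 * (M / u ^ 2)) := by gcongr
      _ = 2 * (u ^ 2) ^ 2 * M := by field_simp
      _ ≤ 2 * (M : ℝ) ^ 2 * M := by gcongr
      _ ≤ 8 * (M : ℝ) ^ 3 := by nlinarith [pow_pos hM0 3]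
  have h1 := mul_norm_sum_sq_le_sum_correlation
    (fun n => exp ((logPhase (u ^ 6) M n : ℂ) * I)) N H
  have h2 := sum_norm_correlation_logPhase_le hu hNM hM hcond
  set S := ‖∑ n ∈ range N, exp ((logPhase (u ^ 6) M n : ℂ) * I)‖ with hS
  set q := √(M : ℝ) with hq
  have hq0 : 0 < q := Real.sqrt_pos.mpr hM0
  have hq2 : q ^ 2 = M := Real.sq_sqrt hM0.le
  set w := √(H : ℝ) with hw
  have hw0 : 0 < w := Real.sqrt_pos.mpr hH0
  have hw2 : w ^ 2 = H := Real.sq_sqrt hH0.le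
  have hqw : q ≤ u * w := by
    refine (sq_le_sq₀ hq0.le (by positivity)).mp ?_
    rw [mul_pow, hq2, hw2]
    rw [div_le_iff₀ (by positivity)] at hHlo
    linarith
  have hwq : u * w ≤ 3 / 2 * q := by
    refine (sq_le_sq₀ (by positivity) (by positivity)).mp ?_
    rw [mul_pow, mul_pow, hq2, hw2]
    have : u ^ 2 * H ≤ 2 * M := by
      calc u ^ 2 * H ≤ u ^ 2 * (2 * (M / u ^ 2)) := by gcongr
        _ = _ := by field_simp
    linarith
  have hqu : q ≤ u ^ 2 := by
    refine (sq_le_sq₀ hq0.le (by positivity)).mp ?_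
    rw [hq2]; calc (M : ℝ) ≤ u ^ 4 := hM2
      _ = _ := by ring
  have hNH : (N : ℝ) + H ≤ 2 * q ^ 2 := by
    rw [hq2]; exact_mod_cast (by omega : N + H ≤ 2 * M)
  -- The constant is 4(1 + 80(3/2 + 2)) = 1124, below 100².
  have h3 : w ^ 2 * S ^ 2 ≤ w ^ 2 * (1124 * (q ^ 2 * u ^ 2)) := by
    rw [← hw2] at h1
    calc w ^ 2 * S ^ 2 ≤ _ := h1
      _ ≤ 2 * (2 * q ^ 2) * (q ^ 2 + 80 * (u ^ 3 * w ^ 3 / q + 2 * (q ^ 3 * w / u ^ 3))) := by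
        rw [hw2]
        gcongr
      _ ≤ 2 * (2 * q ^ 2) * ((u * w) ^ 2
          + 80 * (u ^ 2 * w ^ 2 * (3 / 2) + 2 * (u ^ 2 * w ^ 2))) := by
        have k1 : u ^ 3 * w ^ 3 / q ≤ u ^ 2 * w ^ 2 * (3 / 2) := by
          rw [div_le_iff₀ hq0]
          calc u ^ 3 * w ^ 3 = u ^ 2 * w ^ 2 * (u * w) := by ring
            _ ≤ u ^ 2 * w ^ 2 * (3 / 2 * q) := by gcongr
            _ = _ := by ring
        have k2 : q ^ 3 * w / u ^ 3 ≤ u ^ 2 * w ^ 2 := by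
          rw [div_le_iff₀ (by positivity)]
          calc q ^ 3 * w = q * q * q * w := by ring
            _ ≤ (u * w) * u ^ 2 * u ^ 2 * w := by gcongr
            _ = _ := by ring
        gcongr
      _ = _ := by ring
  have h4 : S ^ 2 ≤ 1124 * (q ^ 2 * u ^ 2) := le_of_mul_le_mul_left h3 (by positivity)
  refine (sq_le_sq₀ (norm_nonneg _) (by positivity)).mp (h4.trans ?_)
  have : 0 ≤ q ^ 2 * u ^ 2 := by positivity
  nlinarith

/-- Dyadic blocks of `∑ n ^ (-it)` for `t = u ^ 6`. -/
theorem norm_sum_logPhase_le {u : ℝ} (hu : 1 ≤ u) {M N : ℕ} (hM : 0 < M) (hNM : N ≤ M)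
    (hMu : (M : ℝ) ≤ 4 * u ^ 12) :
    ‖∑ n ∈ range N, exp ((logPhase (u ^ 6) M n : ℂ) * I)‖ ≤ 100 * √M * u := by
  have hu0 : 0 < u := by linarith
  have hM0 : (0 : ℝ) < M := by exact_mod_cast hM
  have hNM' : (N : ℝ) ≤ M := by exact_mod_cast hNM
  have hq0 : 0 < √(M : ℝ) := Real.sqrt_pos.mpr hM0
  have hq2 : √(M : ℝ) ^ 2 = M := Real.sq_sqrt hM0.le
  -- With t = u⁶: the trivial bound up to t^(1/3), differencing up to t^(2/3), the second-difference
  -- test up to t, and Kusmin–Landau beyond.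
  rcases le_total (M : ℝ) (u ^ 2) with h1 | h1
  · refine (norm_sum_exp_le_card _ N).trans (hNM'.trans ?_)
    have hqu : √(M : ℝ) ≤ u := Real.sqrt_le_iff.mpr ⟨hu0.le, h1⟩
    set q := √(M : ℝ)
    nlinarith
  rcases le_total (M : ℝ) (u ^ 4) with h2 | h2
  · exact norm_sum_logPhase_le_of_mid hu hNM h1 h2
  rcases le_total (M : ℝ) (u ^ 6) with h3 | h3
  · have hu68 : u ^ 6 ≤ 4 * (M : ℝ) ^ 2 := by
      have : u ^ 6 ≤ u ^ 8 := pow_le_pow_right₀ hu (by norm_num)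
      have h4 : (u ^ 4) ^ 2 ≤ (M : ℝ) ^ 2 := by gcongr
      nlinarith
    refine (norm_sum_logPhase_le_of_second_diff (by positivity) hNM hM hu68).trans ?_
    have hqlo : u ^ 2 ≤ √(M : ℝ) := by
      refine Real.le_sqrt_of_sq_le ?_
      calc (u ^ 2) ^ 2 = u ^ 4 := by ring
        _ ≤ (M : ℝ) := h2
    have hqhi : √(M : ℝ) ≤ u ^ 3 := Real.sqrt_le_iff.mpr ⟨by positivity, by
      calc (M : ℝ) ≤ u ^ 6 := h3
        _ = _ := by ring⟩
    have e : √(u ^ 6 / (4 * (M : ℝ) ^ 2)) = u ^ 3 / (2 * M) := by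
      rw [Real.sqrt_eq_iff_eq_sq (by positivity) (by positivity)]; ring
    rw [e]
    calc ((N : ℝ) * (u ^ 6 / M ^ 2) + 2) * (14 / (u ^ 3 / (2 * M)))
        ≤ (M * (u ^ 6 / M ^ 2) + 2) * (14 / (u ^ 3 / (2 * M))) := by gcongr
      _ = 28 * (u ^ 2 * u) + 56 * (√(M : ℝ) * √(M : ℝ) / u ^ 3) := by
        rw [← sq, hq2]; field_simp; ring
      _ ≤ 28 * (√(M : ℝ) * u) + 56 * (√(M : ℝ) * u) := by
        have : √(M : ℝ) * √(M : ℝ) / u ^ 3 ≤ √(M : ℝ) * u := by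
          rw [div_le_iff₀ (by positivity), mul_assoc]
          gcongr
          nlinarith [pow_pos hu0 3]
        gcongr
      _ ≤ _ := by nlinarith [mul_pos hq0 hu0]
  · refine (norm_sum_logPhase_le_of_large (by positivity) hNM h3).trans ?_
    have hqhi : √(M : ℝ) ≤ 2 * u ^ 6 := Real.sqrt_le_iff.mpr ⟨by positivity, by
      calc (M : ℝ) ≤ 4 * u ^ 12 := hMu
        _ = _ := by ring⟩
    rw [div_le_iff₀ (by positivity)]
    set q := √(M : ℝ) with hq
    rw [← hq2]
    calc 20 * q ^ 2 = 20 * q * q := by ring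
      _ ≤ 20 * q * (2 * u ^ 6) := by gcongr
      _ = 40 * q * 1 * u ^ 6 := by ring
      _ ≤ 100 * q * u * u ^ 6 := by gcongr; norm_num

/-! ### The Weyl bound on the critical line. -/

theorem natCast_cpow_half_add (t : ℝ) {M : ℕ} (hM : 0 < M) (n : ℕ) :
    ((M + n : ℕ) : ℂ) ^ (-(1 / 2 + (t : ℂ) * I))
      = ((1 / √((M + n : ℕ) : ℝ) : ℝ) : ℂ) * exp ((logPhase t M n : ℂ) * I) := by
  have h0 : (0 : ℝ) < ((M + n : ℕ) : ℝ) := by exact_mod_cast (by omega : 0 < M + n)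
  have hne : ((M + n : ℕ) : ℂ) ≠ 0 := by exact_mod_cast (by omega : M + n ≠ 0)
  have e1 : (1 / √((M + n : ℕ) : ℝ) : ℝ) = Real.exp (-(1 / 2) * Real.log ((M + n : ℕ) : ℝ)) := by
    rw [Real.sqrt_eq_rpow, one_div, ← Real.rpow_neg h0.le, Real.rpow_def_of_pos h0]
    ring_nf
  rw [cpow_def_of_ne_zero hne, e1, Complex.ofReal_exp, ← Complex.exp_add, ← Complex.natCast_log]
  congr 1
  simp only [logPhase]
  push_cast
  ring

theorem norm_dyadic_block_le {u : ℝ} (hu : 1 ≤ u) {M : ℕ} (hM : 0 < M)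
    (hMu : (M : ℝ) ≤ 4 * u ^ 12) :
    ‖∑ n ∈ range M, ((M + n : ℕ) : ℂ) ^ (-(1 / 2 + ((u ^ 6 : ℝ) : ℂ) * I))‖ ≤ 100 * u := by
  have hM0 : (0 : ℝ) < M := by exact_mod_cast hM
  simp only [natCast_cpow_half_add _ hM]
  have h := norm_sum_antitone_mul_le (fun n => 1 / √((M + n : ℕ) : ℝ))
    (fun n => exp ((logPhase (u ^ 6) M n : ℂ) * I)) M (100 * √M * u)
    (fun n => by positivity) ?_ (fun m hm => norm_sum_logPhase_le hu hM hm hMu)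
  · refine h.trans (le_of_eq ?_)
    have : √(M : ℝ) ≠ 0 := (Real.sqrt_pos.mpr hM0).ne'
    simp only [add_zero]
    field_simp
  · intro n
    have : 0 < √((M + n : ℕ) : ℝ) := Real.sqrt_pos.mpr (by exact_mod_cast (by omega : 0 < M + n))
    gcongr
    omega

theorem sum_range_two_pow_sub_one (f : ℕ → ℂ) (J : ℕ) :
    ∑ i ∈ range (2 ^ J - 1), f (i + 1) = ∑ j ∈ range J, ∑ n ∈ range (2 ^ j), f (2 ^ j + n) := by
  induction J with
  | zero => simp
  | succ J ih =>
    have h1 : 0 < 2 ^ J := by positivity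
    have h2 : 2 ^ (J + 1) - 1 = (2 ^ J - 1) + 2 ^ J := by rw [pow_succ]; omega
    rw [h2, Finset.sum_range_add, ih, Finset.sum_range_succ]
    congr 1
    refine Finset.sum_congr rfl fun n _ => ?_
    congr 1
    omega

/-- The Weyl bound for the zeta-function on the critical line. -/
theorem norm_riemannZeta_half_le {u : ℝ} (hu : 1 ≤ u) :
    ‖riemannZeta (1 / 2 + ((u ^ 6 : ℝ) : ℂ) * I)‖ ≤ 100 * u * (2 + 18 * Real.log u) + 10 := by
  have hu0 : 0 < u := by linarith
  set t : ℝ := u ^ 6 with ht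
  have ht1 : 1 ≤ t := one_le_pow₀ hu
  have ht2 : t ^ 2 = u ^ 12 := by rw [ht]; ring
  set s : ℂ := 1 / 2 + (t : ℂ) * I with hs
  have hre : s.re = 1 / 2 := by simp [hs]
  have him : s.im = t := by simp [hs]
  have hs1 : s ≠ 1 := by
    intro h; rw [h] at hre; norm_num at hre
  -- The truncation point 2^J lies between t² and 4t², which makes both truncation errors bounded.
  set J : ℕ := Nat.clog 2 ⌈u ^ 12⌉₊ with hJ
  have hJlo : u ^ 12 ≤ (2 ^ J : ℕ) :=
    (Nat.le_ceil _).trans (by exact_mod_cast Nat.le_pow_clog (by norm_num) _)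
  have hjhi : ∀ j < J, ((2 ^ j : ℕ) : ℝ) ≤ 2 * u ^ 12 := by
    intro j hj
    have h1 : 2 ^ j < ⌈u ^ 12⌉₊ := (Nat.lt_clog_iff_pow_lt (by norm_num)).mp hj
    have h2 : ((2 ^ j : ℕ) : ℝ) ≤ (⌈u ^ 12⌉₊ : ℝ) := by exact_mod_cast h1.le
    have h3 := (Nat.ceil_lt_add_one (by positivity : 0 ≤ u ^ 12)).le
    have h4 : 1 ≤ u ^ 12 := one_le_pow₀ hu
    linarith
  have hJhi : ((2 ^ J : ℕ) : ℝ) ≤ 4 * u ^ 12 := by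
    rcases Nat.eq_zero_or_pos J with h | h
    · rw [h]; have h4 : 1 ≤ u ^ 12 := one_le_pow₀ hu
      norm_num; linarith
    · have h1 := hjhi (J - 1) (by omega)
      have h2 : 2 ^ J = 2 * 2 ^ (J - 1) := by
        rw [← pow_succ']; congr 1; omega
      rw [h2]; push_cast at h1 ⊢; linarith
  -- From 2^J ≤ 4u¹² and 12/log 2 < 18.
  have hJlog : (J : ℝ) ≤ 2 + 18 * Real.log u := by
    have h1 := Real.log_le_log (by positivity) hJhi
    rw [Real.log_mul (by norm_num) (by positivity), Real.log_pow] at h1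
    push_cast at h1
    rw [Real.log_pow, show (4 : ℝ) = 2 ^ 2 by norm_num, Real.log_pow] at h1
    have h2 := Real.log_two_gt_d9
    have h3 : 0 ≤ Real.log u := Real.log_nonneg hu
    push_cast at h1
    by_contra! hcon
    nlinarith
  have h := norm_riemannZeta_sub_le (by rw [hre]; norm_num) hs1 (2 ^ J - 1)
  have hK : 2 ^ J - 1 + 1 = 2 ^ J := Nat.sub_add_cancel Nat.one_le_two_pow
  have htail := tsum_rpow_neg_three_halves_le (2 ^ J - 1)
  rw [hre] at h
  rw [hK] at h htail
  rw [sum_range_two_pow_sub_one (fun n => (n : ℂ) ^ (-s))] at h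
  have hblocks : ‖∑ j ∈ range J, ∑ n ∈ range (2 ^ j), ((2 ^ j + n : ℕ) : ℂ) ^ (-s)‖
      ≤ J * (100 * u) := by
    refine (norm_sum_le _ _).trans ?_
    refine (Finset.sum_le_sum fun j hj => norm_dyadic_block_le hu (M := 2 ^ j) (by positivity)
      ((hjhi j (mem_range.mp hj)).trans ?_)).trans_eq ?_
    · have : 0 < u ^ 12 := by positivity
      linarith
    · simp
  set R : ℝ := ((2 ^ J : ℕ) : ℝ) with hR
  have hR0 : 0 < R := by rw [hR]; positivity
  have hsqlo : t ≤ √R := Real.le_sqrt_of_sq_le (by rw [ht2]; exact hJlo)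
  have hsqhi : √R ≤ 2 * t := Real.sqrt_le_iff.mpr ⟨by positivity, by rw [mul_pow, ht2]; linarith⟩
  have hsn : t ≤ ‖s - 1‖ := by
    have := Complex.abs_im_le_norm (s - 1)
    rw [sub_im, him, one_im, sub_zero, abs_of_nonneg (by linarith)] at this
    exact this
  have hsn2 : ‖s‖ ≤ 2 * t := by
    have := Complex.norm_le_abs_re_add_abs_im s
    rw [hre, him, abs_of_nonneg (by linarith : 0 ≤ t), abs_of_nonneg (by norm_num)] at this
    linarith
  have e1 : R ^ (1 - (1 / 2 : ℝ)) / ‖s - 1‖ ≤ 2 := by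
    have : (1 - (1 / 2 : ℝ)) = 1 / 2 := by norm_num
    rw [this, ← Real.sqrt_eq_rpow, div_le_iff₀ (by linarith)]
    linarith
  have e2 : ‖s‖ * ∑' i : ℕ, ((i + (2 ^ J - 1) + 1 : ℕ) : ℝ) ^ (-(1 / 2 : ℝ) - 1) ≤ 8 := by
    calc _ ≤ 2 * t * (4 / √R) := by
          refine mul_le_mul hsn2 htail (tsum_nonneg fun i => by positivity) (by positivity)
      _ ≤ 8 := by
        rw [← mul_div_assoc, div_le_iff₀ (by linarith)]
        linarith
  have hfin := norm_sub_norm_le (riemannZeta s)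
    (∑ j ∈ range J, ∑ n ∈ range (2 ^ j), ((2 ^ j + n : ℕ) : ℂ) ^ (-s))
  have : (J : ℝ) * (100 * u) ≤ 100 * u * (2 + 18 * Real.log u) := by
    rw [mul_comm]; gcongr
  linarith

/-! ### Order of growth on the critical line, convexity and the derivative. -/

/-- The zeta-function has polynomial order at most `A` on the critical line. -/
def ZetaOrderLE (A : ℝ) : Prop :=
  ∃ K : ℝ, ∀ t : ℝ, ‖riemannZeta (1 / 2 + (t : ℂ) * I)‖ ≤ K * (1 + |t|) ^ A

theorem norm_riemannZeta_half_neg (t : ℝ) :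
    ‖riemannZeta (1 / 2 + ((-t : ℝ) : ℂ) * I)‖ = ‖riemannZeta (1 / 2 + (t : ℂ) * I)‖ := by
  rw [← RCLike.norm_conj (riemannZeta (1 / 2 + (t : ℂ) * I)), ← riemannZeta_conj]
  congr 2
  simp only [map_add, map_mul, conj_ofReal, conj_I, map_div₀, map_one, map_ofNat]
  push_cast; ring

theorem zetaOrderLE_of_one_sixth_lt {A : ℝ} (hA : 1 / 6 < A) : ZetaOrderLE A := by
  obtain ⟨C, hC0, hC⟩ := exists_norm_riemannZeta_le_linear
  -- Chosen so that u · u^η = t^A when u = t^(1/6); the factor u^η absorbs the logarithm.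
  set η : ℝ := 6 * A - 1 with hη
  have hη0 : 0 < η := by linarith
  refine ⟨max (2 * C) (210 + 1800 / η), fun t => ?_⟩
  wlog ht : 0 ≤ t generalizing t
  · have := this (-t) (by linarith)
    rwa [norm_riemannZeta_half_neg, abs_neg] at this
  rw [abs_of_nonneg ht]
  have hpow : 1 ≤ (1 + t) ^ A := Real.one_le_rpow (by linarith) (by linarith)
  rcases le_total t 1 with h1 | h1
  · have := hC (1 / 2 + (t : ℂ) * I) (by simp; norm_num) (by simp; norm_num)
    simp only [add_im, mul_im, ofReal_re, I_im, ofReal_im, I_re] at this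
    norm_num at this
    rw [abs_of_nonneg ht] at this
    norm_num at *
    calc _ ≤ C * (1 + t) := this
      _ ≤ 2 * C * 1 := by nlinarith
      _ ≤ max (2 * C) (210 + 1800 / η) * (1 + t) ^ A := by
        gcongr
        exact le_max_left _ _
  · set u : ℝ := t ^ (1 / 6 : ℝ) with hu
    have hu1 : 1 ≤ u := Real.one_le_rpow h1 (by norm_num)
    have hu0 : 0 < u := by linarith
    have hu6 : u ^ 6 = t := by
      rw [hu, ← Real.rpow_natCast, ← Real.rpow_mul ht]; norm_num
    have h := norm_riemannZeta_half_le hu1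
    rw [hu6] at h
    have hlog : Real.log u ≤ u ^ η / η := Real.log_le_rpow_div hu0.le hη0
    have hua : u * u ^ η ≤ (1 + t) ^ A := by
      rw [← Real.rpow_one_add' hu0.le (by linarith), hu, ← Real.rpow_mul ht]
      rw [show 1 / 6 * (1 + η) = A by rw [hη]; ring]
      exact Real.rpow_le_rpow ht (by linarith) (by linarith)
    have huη : 1 ≤ u ^ η := Real.one_le_rpow hu1 hη0.le
    calc _ ≤ 100 * u * (2 + 18 * Real.log u) + 10 := h
      _ ≤ 100 * u * (2 + 18 * (u ^ η / η)) + 10 := by gcongr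
      _ = 200 * u + 10 + 1800 / η * (u * u ^ η) := by ring
      _ ≤ 210 * (u * u ^ η) + 1800 / η * (u * u ^ η) := by
        have : u ≤ u * u ^ η := le_mul_of_one_le_right hu0.le huη
        linarith
      _ = (210 + 1800 / η) * (u * u ^ η) := by ring
      _ ≤ max (2 * C) (210 + 1800 / η) * (1 + t) ^ A := by
        gcongr
        exact le_max_right _ _

theorem one_add_mul_exp_neg_sq_le (x : ℝ) : (1 + |x|) * Real.exp (-x ^ 2) ≤ 2 := by
  rw [Real.exp_neg, ← div_eq_mul_inv, div_le_iff₀ (Real.exp_pos _)]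
  have := Real.add_one_le_exp (x ^ 2)
  nlinarith [sq_abs x, sq_nonneg (|x| - 1), abs_nonneg x]

theorem one_add_abs_rpow_le {b : ℝ} (hb0 : 0 ≤ b) (hb1 : b ≤ 1) (u y : ℝ) :
    (1 + |y|) ^ b ≤ (1 + |u|) ^ b * (1 + |y - u|) := by
  have h1 : 1 + |y| ≤ (1 + |u|) * (1 + |y - u|) := by
    have := abs_add_le u (y - u)
    rw [add_sub_cancel] at this
    nlinarith [mul_nonneg (abs_nonneg u) (abs_nonneg (y - u))]
  calc (1 + |y|) ^ b ≤ ((1 + |u|) * (1 + |y - u|)) ^ b := by gcongr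
    _ = (1 + |u|) ^ b * (1 + |y - u|) ^ b := Real.mul_rpow (by positivity) (by positivity)
    _ ≤ (1 + |u|) ^ b * (1 + |y - u|) ^ (1 : ℝ) := by
      gcongr
      linarith [abs_nonneg (y - u)]
    _ = _ := by rw [Real.rpow_one]

/-- The zeta-function damped away from height `u`. -/
noncomputable def dampedZeta (u : ℝ) (z : ℂ) : ℂ :=
  riemannZeta z * exp ((z - (1 / 2 + (u : ℂ) * I)) ^ 2)

theorem norm_exp_sq_sub (u : ℝ) (z : ℂ) :
    ‖exp ((z - (1 / 2 + (u : ℂ) * I)) ^ 2)‖ = Real.exp ((z.re - 1 / 2) ^ 2 - (z.im - u) ^ 2) := by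
  rw [Complex.norm_exp]
  congr 1
  rw [sq, mul_re]
  simp
  ring

theorem norm_dampedZeta_le {K b : ℝ} (hb0 : 0 ≤ b) (hb1 : b ≤ 1) (u : ℝ) {z : ℂ}
    (h1 : 1 / 4 ≤ z.re) (h2 : z.re ≤ 3 / 4) (hK : 0 ≤ K)
    (hz : ‖riemannZeta z‖ ≤ K * (1 + |z.im|) ^ b) :
    ‖dampedZeta u z‖ ≤ 4 * K * (1 + |u|) ^ b := by
  rw [dampedZeta, norm_mul, norm_exp_sq_sub, sub_eq_add_neg, Real.exp_add]
  have he : Real.exp ((z.re - 1 / 2) ^ 2) ≤ 2 := by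
    have : (z.re - 1 / 2) ^ 2 ≤ 1 / 16 := by nlinarith
    refine (Real.exp_le_exp.mpr this).trans ?_
    rw [← Real.le_log_iff_exp_le (by norm_num)]
    linarith [Real.log_two_gt_d9]
  calc _ ≤ (K * ((1 + |u|) ^ b * (1 + |z.im - u|))) * (2 * Real.exp (-(z.im - u) ^ 2)) := by
        gcongr
        exact hz.trans (by gcongr; exact one_add_abs_rpow_le hb0 hb1 u z.im)
    _ = 2 * K * (1 + |u|) ^ b * ((1 + |z.im - u|) * Real.exp (-(z.im - u) ^ 2)) := by ring
    _ ≤ 2 * K * (1 + |u|) ^ b * 2 := by gcongr; exact one_add_mul_exp_neg_sq_le _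
    _ = _ := by ring

/-- Hadamard's three lines theorem for the damped function centred at the height of s. The Gaussian
factor turns polynomial growth into boundedness and costs only a constant on the two edges. -/
theorem norm_riemannZeta_le_interp {l r b₁ b₂ K C : ℝ} (hlr : l < r) (hl : 1 / 4 ≤ l)
    (hr : r ≤ 3 / 4) (hK : 0 < K) (hb₁ : 0 ≤ b₁) (hb₁' : b₁ ≤ 1) (hb₂ : 0 ≤ b₂) (hb₂' : b₂ ≤ 1)
    (hC : 0 < C) (hlin : ∀ s : ℂ, 1 / 4 ≤ s.re → s.re ≤ 3 / 4 → ‖riemannZeta s‖ ≤ C * (1 + |s.im|))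
    (h₁ : ∀ z : ℂ, z.re = l → ‖riemannZeta z‖ ≤ K * (1 + |z.im|) ^ b₁)
    (h₂ : ∀ z : ℂ, z.re = r → ‖riemannZeta z‖ ≤ K * (1 + |z.im|) ^ b₂)
    {s : ℂ} (hs1 : l ≤ s.re) (hs2 : s.re ≤ r) :
    ‖riemannZeta s‖ ≤ 4 * K * (1 + |s.im|) ^
      (b₁ * (1 - (s.re - l) / (r - l)) + b₂ * ((s.re - l) / (r - l))) := by
  set X := 1 + |s.im| with hX
  have hX0 : 0 < X := by positivity
  set τ := (s.re - l) / (r - l) with hτ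
  have hcl : closure (HadamardThreeLines.verticalStrip l r) ⊆
      HadamardThreeLines.verticalClosedStrip l r := by
    refine closure_minimal (Set.preimage_mono Set.Ioo_subset_Icc_self) ?_
    exact isClosed_Icc.preimage Complex.continuous_re
  have hd : DiffContOnCl ℂ (dampedZeta s.im) (HadamardThreeLines.verticalStrip l r) := by
    refine DifferentiableOn.diffContOnCl fun z hz => ?_
    have hz2 : z.re ≤ r := (hcl hz).2
    have hz1 : z ≠ 1 := by rintro rfl; norm_num at hz2; linarith
    have := differentiableAt_riemannZeta hz1
    unfold dampedZeta
    exact (this.mul (by fun_prop)).differentiableWithinAt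
  have hB : BddAbove ((norm ∘ dampedZeta s.im) '' HadamardThreeLines.verticalClosedStrip l r) := by
    refine ⟨4 * C * (1 + |s.im|) ^ (1 : ℝ), ?_⟩
    rintro _ ⟨z, hz, rfl⟩
    have hz1 : l ≤ z.re := hz.1
    have hz2 : z.re ≤ r := hz.2
    refine norm_dampedZeta_le zero_le_one le_rfl _ (by linarith) (by linarith) hC.le ?_
    rw [Real.rpow_one]
    exact hlin z (by linarith) (by linarith)
  have h := HadamardThreeLines.norm_le_interp_of_mem_verticalClosedStrip' hlr
    (z := s) ⟨hs1, hs2⟩ hd hB (a := 4 * K * X ^ b₁) (b := 4 * K * X ^ b₂) ?_ ?_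
  · have hge : ‖riemannZeta s‖ ≤ ‖dampedZeta s.im s‖ := by
      rw [dampedZeta, norm_mul, norm_exp_sq_sub]
      refine le_mul_of_one_le_right (norm_nonneg _) (Real.one_le_exp ?_)
      simp; positivity
    refine hge.trans (h.trans (le_of_eq ?_))
    rw [← hτ, Real.mul_rpow (x := 4 * K) (y := X ^ b₁) (by positivity) (by positivity),
      Real.mul_rpow (x := 4 * K) (y := X ^ b₂) (by positivity) (by positivity),
      ← Real.rpow_mul hX0.le, ← Real.rpow_mul hX0.le, Real.rpow_add hX0]
    have : (4 * K) ^ (1 - τ) * (4 * K) ^ τ = 4 * K := by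
      rw [← Real.rpow_add (by positivity)]; simp
    calc _ = ((4 * K) ^ (1 - τ) * (4 * K) ^ τ) * (X ^ (b₁ * (1 - τ)) * X ^ (b₂ * τ)) := by ring
      _ = _ := by rw [this]
  · intro z hz
    have hz : z.re = l := hz
    exact norm_dampedZeta_le hb₁ hb₁' _ (by linarith) (by linarith) hK.le (h₁ z hz)
  · intro z hz
    have hz : z.re = r := hz
    exact norm_dampedZeta_le hb₂ hb₂' _ (by linarith) (by linarith) hK.le (h₂ z hz)

theorem ZetaOrderLE.exists_norm_le {A : ℝ} (h : ZetaOrderLE A) :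
    ∃ K : ℝ, 0 < K ∧ ∀ t : ℝ, ‖riemannZeta (1 / 2 + (t : ℂ) * I)‖ ≤ K * (1 + |t|) ^ A := by
  obtain ⟨K, hK⟩ := h
  refine ⟨max K 1, by positivity, fun t => (hK t).trans ?_⟩
  gcongr
  exact le_max_left _ _

/-- Bounds for zeta near the critical line in terms of its order on the line. -/
theorem ZetaOrderLE.exists_norm_le_strip {B : ℝ} (hB0 : 0 ≤ B) (hB1 : B ≤ 1) (hB : ZetaOrderLE B) :
    ∃ K : ℝ, 0 < K ∧ ∀ s : ℂ, 1 / 4 ≤ s.re → s.re ≤ 3 / 4 →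
      ‖riemannZeta s‖ ≤ K * (1 + |s.im|) ^ (B + 4 * |s.re - 1 / 2|) := by
  obtain ⟨C, hC0, hC⟩ := exists_norm_riemannZeta_le_linear
  obtain ⟨K, hK0, hK⟩ := hB.exists_norm_le
  set M := max K C with hM
  have hM0 : 0 < M := lt_max_of_lt_left hK0
  have hmid : ∀ z : ℂ, z.re = 1 / 2 → ‖riemannZeta z‖ ≤ M * (1 + |z.im|) ^ B := by
    intro z hz
    have e : z = 1 / 2 + (z.im : ℂ) * I := by
      apply Complex.ext <;> simp [hz]
    calc ‖riemannZeta z‖ = ‖riemannZeta (1 / 2 + (z.im : ℂ) * I)‖ := by rw [← e]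
      _ ≤ K * (1 + |z.im|) ^ B := hK z.im
      _ ≤ _ := by gcongr; exact le_max_left _ _
  have hside : ∀ z : ℂ, 1 / 4 ≤ z.re → z.re ≤ 3 / 4 →
      ‖riemannZeta z‖ ≤ M * (1 + |z.im|) ^ (1 : ℝ) := by
    intro z h1 h2
    rw [Real.rpow_one]
    refine (hC z h1 h2).trans ?_
    gcongr; exact le_max_right _ _
  refine ⟨4 * M, by positivity, fun s h1 h2 => ?_⟩
  have hX : 1 ≤ 1 + |s.im| := by linarith [abs_nonneg s.im]
  rcases le_total s.re (1 / 2) with h | h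
  · have := norm_riemannZeta_le_interp (l := 1 / 4) (r := 1 / 2) (by norm_num) le_rfl (by norm_num)
      hM0 zero_le_one le_rfl hB0 hB1 hC0 hC
      (fun z hz => hside z (by linarith) (by linarith)) hmid h1 h
    refine this.trans ?_
    refine mul_le_mul_of_nonneg_left (Real.rpow_le_rpow_of_exponent_le hX ?_) (by positivity)
    · rw [abs_of_nonpos (by linarith)]
      have : (s.re - 1 / 4) / (1 / 2 - 1 / 4) = 4 * s.re - 1 := by ring
      rw [this]
      nlinarith
  · have := norm_riemannZeta_le_interp (l := 1 / 2) (r := 3 / 4) (by norm_num) (by norm_num) le_rfl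
      hM0 hB0 hB1 zero_le_one le_rfl hC0 hC hmid
      (fun z hz => hside z (by linarith) (by linarith)) h h2
    refine this.trans ?_
    refine mul_le_mul_of_nonneg_left (Real.rpow_le_rpow_of_exponent_le hX ?_) (by positivity)
    · rw [abs_of_nonneg (by linarith)]
      have : (s.re - 1 / 2) / (3 / 4 - 1 / 2) = 4 * s.re - 2 := by ring
      rw [this]
      nlinarith

/-- Cauchy's estimate on a circle of radius δ/4, on which the strip exponent B + 4|σ - 1/2| is at
most B + δ. -/
theorem ZetaOrderLE.exists_norm_deriv_le {B δ : ℝ} (hB0 : 0 ≤ B) (hB1 : B ≤ 1) (hδ : 0 < δ)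
    (hδ1 : δ ≤ 1) (hB : ZetaOrderLE B) :
    ∃ K : ℝ, 0 < K ∧ ∀ t : ℝ, ‖deriv riemannZeta (1 / 2 + (t : ℂ) * I)‖
      ≤ K * (1 + |t|) ^ (B + δ) := by
  obtain ⟨K, hK0, hK⟩ := hB.exists_norm_le_strip hB0 hB1
  refine ⟨K * 2 ^ (B + δ) / (δ / 4), by positivity, fun t => ?_⟩
  have hr : 0 < δ / 4 := by positivity
  have hre : ((1 / 2 + (t : ℂ) * I) : ℂ).re = 1 / 2 := by simp
  have him : ((1 / 2 + (t : ℂ) * I) : ℂ).im = t := by simp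
  have hpt : ∀ z : ℂ, ‖z - (1 / 2 + (t : ℂ) * I)‖ ≤ δ / 4 →
      |z.re - 1 / 2| ≤ δ / 4 ∧ |z.im - t| ≤ δ / 4 := by
    intro z hz
    have h1 := (Complex.abs_re_le_norm _).trans hz
    have h2 := (Complex.abs_im_le_norm _).trans hz
    rw [sub_re, hre] at h1
    rw [sub_im, him] at h2
    exact ⟨h1, h2⟩
  have h := Complex.norm_deriv_le_of_forall_mem_sphere_norm_le (c := 1 / 2 + (t : ℂ) * I) hr
    (f := riemannZeta) (C := K * (2 * (1 + |t|)) ^ (B + δ)) ?_ ?_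
  · rw [Real.mul_rpow (by norm_num) (by positivity)] at h
    refine h.trans (le_of_eq ?_)
    ring
  · refine DifferentiableOn.diffContOnCl fun z hz => ?_
    rw [closure_ball _ hr.ne', Metric.mem_closedBall, dist_eq_norm] at hz
    have h1 := abs_le.mp (hpt z hz).1
    have hz1 : z ≠ 1 := by
      rintro rfl
      rw [one_re] at h1
      linarith [h1.2]
    exact (differentiableAt_riemannZeta hz1).differentiableWithinAt
  · intro z hz
    rw [mem_sphere_iff_norm] at hz
    obtain ⟨h1, h2⟩ := hpt z hz.le
    have h1' := abs_le.mp h1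
    refine (hK z (by linarith) (by linarith)).trans ?_
    have h3 : 1 + |z.im| ≤ 2 * (1 + |t|) := by
      have := abs_add_le t (z.im - t)
      rw [add_sub_cancel] at this
      linarith [abs_nonneg t]
    have h4 : 1 ≤ 2 * (1 + |t|) := by linarith [abs_nonneg t]
    gcongr
    calc (1 + |z.im|) ^ (B + 4 * |z.re - 1 / 2|)
        ≤ (2 * (1 + |t|)) ^ (B + 4 * |z.re - 1 / 2|) := by gcongr
      _ ≤ (2 * (1 + |t|)) ^ (B + δ) := Real.rpow_le_rpow_of_exponent_le h4 (by linarith)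

theorem ZetaOrderLE.exists_norm_sub_le {B δ : ℝ} (hB0 : 0 ≤ B) (hB1 : B ≤ 1) (hδ : 0 < δ)
    (hδ1 : δ ≤ 1) (hB : ZetaOrderLE B) :
    ∃ K : ℝ, 0 < K ∧ ∀ t x : ℝ, 1 ≤ t → t ≤ x → x ≤ t + 1 →
      ‖riemannZeta (1 / 2 + (x : ℂ) * I) - riemannZeta (1 / 2 + (t : ℂ) * I)‖
        ≤ K * t ^ (B + δ) * (x - t) := by
  obtain ⟨K, hK0, hK⟩ := hB.exists_norm_deriv_le hB0 hB1 hδ hδ1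
  refine ⟨K * 3 ^ (B + δ), by positivity, fun t x ht htx hx => ?_⟩
  have hderiv : ∀ y ∈ Set.Icc t x, HasDerivWithinAt
      (fun y : ℝ => riemannZeta (1 / 2 + (y : ℂ) * I))
      (deriv riemannZeta (1 / 2 + (y : ℂ) * I) * I) (Set.Icc t x) y := by
    intro y _
    have hne : (1 / 2 + (y : ℂ) * I) ≠ 1 := by
      intro h
      have := congrArg Complex.re h
      norm_num at this
    have h1 := (differentiableAt_riemannZeta hne).hasDerivAt
    have h2 : HasDerivAt (fun y : ℝ => (1 / 2 + (y : ℂ) * I)) I y := by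
      simpa using ((Complex.ofRealCLM.hasDerivAt (x := y)).mul_const I).const_add (1 / 2)
    exact (h1.comp y h2).hasDerivWithinAt
  have hbd : ∀ y ∈ Set.Icc t x,
      ‖deriv riemannZeta (1 / 2 + (y : ℂ) * I) * I‖ ≤ K * 3 ^ (B + δ) * t ^ (B + δ) := by
    intro y hy
    rw [norm_mul, Complex.norm_I, mul_one]
    refine (hK y).trans ?_
    rw [mul_assoc, ← Real.mul_rpow (by norm_num) (by linarith)]
    have : 1 + |y| ≤ 3 * t := by
      rw [abs_of_nonneg (by linarith [hy.1])]
      linarith [hy.2]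
    gcongr
  have := (convex_Icc t x).norm_image_sub_le_of_norm_hasDerivWithin_le hderiv hbd
    (Set.left_mem_Icc.mpr htx) (Set.right_mem_Icc.mpr htx)
  rwa [Real.norm_eq_abs, abs_of_nonneg (by linarith)] at this

/-! ### Increments of E and the extraction of large values. -/

theorem half_add_mul_I_ne_one (t : ℝ) : (1 / 2 + (t : ℂ) * I) ≠ 1 := by
  intro h
  have := congrArg Complex.re h
  norm_num at this

theorem continuous_norm_riemannZeta_half :
    Continuous fun t : ℝ => ‖riemannZeta (1 / 2 + (t : ℂ) * I)‖ := by
  refine continuous_iff_continuousAt.mpr fun t => ContinuousAt.norm ?_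
  exact ContinuousAt.comp (f := fun t : ℝ => (1 / 2 + (t : ℂ) * I))
    (differentiableAt_riemannZeta (half_add_mul_I_ne_one t)).continuousAt (by fun_prop)

theorem continuous_zetaE : Continuous zetaE := by
  unfold zetaE
  refine Continuous.sub ?_ ?_
  · exact intervalIntegral.continuous_primitive
      (fun a b => (continuous_norm_riemannZeta_half.pow 2).intervalIntegrable a b) 0
  · have h1 : Continuous fun T : ℝ => (T / (2 * Real.pi)) * Real.log (T / (2 * Real.pi)) :=
      Real.continuous_mul_log.comp (by fun_prop)
    have hpi : 2 * Real.pi ≠ 0 := by positivity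
    have e : (fun T : ℝ => T * (Real.log (T / (2 * Real.pi))
        + 2 * Real.eulerMascheroniConstant - 1)) = fun T : ℝ =>
        2 * Real.pi * ((T / (2 * Real.pi)) * Real.log (T / (2 * Real.pi)))
          + T * (2 * Real.eulerMascheroniConstant - 1) := by
      funext T; field_simp; ring
    rw [e]
    fun_prop

/-- The main term grows by at most (b - a)(log b + 2), by a(log b - log a) ≤ b - a and γ < 2/3. -/
theorem zetaE_sub_ge {a b : ℝ} (ha : 0 < a) (hab : a ≤ b) :
    (∫ t in a..b, ‖riemannZeta (1 / 2 + (t : ℂ) * I)‖ ^ 2) - (b - a) * (Real.log b + 2)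
      ≤ zetaE b - zetaE a := by
  have hInt : ∀ a b : ℝ, IntervalIntegrable
      (fun t : ℝ => ‖riemannZeta (1 / 2 + (t : ℂ) * I)‖ ^ 2) MeasureTheory.volume a b :=
    fun a b => (continuous_norm_riemannZeta_half.pow 2).intervalIntegrable a b
  have h1 := intervalIntegral.integral_interval_sub_left (hInt 0 b) (hInt 0 a)
  have hb : 0 < b := by linarith
  have hpi : 0 < 2 * Real.pi := by positivity
  have hpi1 : 1 ≤ 2 * Real.pi := by linarith [Real.pi_gt_three]
  have h2 : a * (Real.log b - Real.log a) ≤ b - a := by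
    rw [← Real.log_div hb.ne' ha.ne']
    have := mul_le_mul_of_nonneg_left (Real.log_le_sub_one_of_pos (div_pos hb ha)) ha.le
    refine this.trans (le_of_eq ?_)
    field_simp
  have hγ := Real.eulerMascheroniConstant_lt_two_thirds
  have hl : 0 ≤ Real.log (2 * Real.pi) := Real.log_nonneg hpi1
  have h3 : (b - a) * (2 * Real.eulerMascheroniConstant - Real.log (2 * Real.pi)) ≤ (b - a) * 2 := by
    refine mul_le_mul_of_nonneg_left ?_ (by linarith)
    linarith
  simp only [zetaE]
  rw [← h1, Real.log_div hb.ne' hpi.ne', Real.log_div ha.ne' hpi.ne']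
  nlinarith

theorem ZetaOrderLE.mono {A B : ℝ} (h : ZetaOrderLE A) (hAB : A ≤ B) : ZetaOrderLE B := by
  obtain ⟨K, hK0, hK⟩ := h.exists_norm_le
  refine ⟨K, fun t => (hK t).trans ?_⟩
  exact mul_le_mul_of_nonneg_left
    (Real.rpow_le_rpow_of_exponent_le (by linarith [abs_nonneg t]) hAB) hK0.le

theorem frequently_rpow_lt_of_not_zetaOrderLE {A : ℝ} (hA : 0 ≤ A) (h : ¬ ZetaOrderLE A) :
    ∃ᶠ t : ℝ in atTop, t ^ A < ‖riemannZeta (1 / 2 + (t : ℂ) * I)‖ := by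
  by_contra hcon
  rw [not_frequently] at hcon
  obtain ⟨X, hX⟩ := eventually_atTop.mp hcon
  obtain ⟨C, hC⟩ := (isCompact_Icc (a := 0) (b := max X 0)).exists_bound_of_continuousOn
    continuous_norm_riemannZeta_half.continuousOn
  refine h ⟨max C 1, fun t => ?_⟩
  wlog ht : 0 ≤ t generalizing t
  · have := this (-t) (by linarith)
    rwa [norm_riemannZeta_half_neg, abs_neg] at this
  rw [abs_of_nonneg ht]
  have hpow : 1 ≤ (1 + t) ^ A := Real.one_le_rpow (by linarith) hA
  rcases le_total t (max X 0) with h1 | h1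
  · have := hC t ⟨ht, h1⟩
    rw [norm_norm] at this
    calc _ ≤ max C 1 := this.trans (le_max_left _ _)
      _ ≤ _ := le_mul_of_one_le_right (by positivity) hpow
  · have := not_lt.mp (hX t ((le_max_left _ _).trans h1))
    calc _ ≤ t ^ A := this
      _ ≤ (1 + t) ^ A := Real.rpow_le_rpow ht (by linarith) hA
      _ ≤ _ := le_mul_of_one_le_left (by positivity) (le_max_right _ _)

theorem eventually_le_rpow (K : ℝ) {δ : ℝ} (hδ : 0 < δ) : ∀ᶠ T : ℝ in atTop, K ≤ T ^ δ :=
  (tendsto_rpow_atTop hδ).eventually_ge_atTop K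

theorem eventually_log_add_le_rpow {δ : ℝ} (hδ : 0 < δ) :
    ∀ᶠ T : ℝ in atTop, 32 * (Real.log T + 4) ≤ T ^ δ := by
  have h1 := (isLittleO_log_rpow_atTop hδ).bound (by norm_num : (0 : ℝ) < 1 / 64)
  filter_upwards [h1, eventually_le_rpow 256 hδ, eventually_ge_atTop 1] with T h2 h3 h4
  rw [Real.norm_of_nonneg (Real.log_nonneg h4), Real.norm_of_nonneg (by positivity)] at h2
  linarith

/-! ### Large values against short moments. -/

/-- A large value of zeta that persists to the right forces a large increment of `E`. -/
theorem zetaE_increment_ge {T G η V t : ℝ} (hT : 1 ≤ T) (hη0 : 0 ≤ η) (hηG : η ≤ G)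
    (hGT : G ≤ T / 6) (hV : 0 ≤ V) (ht1 : T - G ≤ t) (ht2 : t ≤ T + G)
    (hlarge : ∀ x, T ≤ x → x ≤ T + η → V / 2 ≤ ‖riemannZeta (1 / 2 + (x : ℂ) * I)‖)
    (hmain : 4 * G * (Real.log T + 4) ≤ η * V ^ 2 / 8) :
    η * V ^ 2 / 8 ≤ zetaE (t + 2 * G) - zetaE (t - 2 * G) := by
  have hG0 : 0 ≤ G := hη0.trans hηG
  have h1 := zetaE_sub_ge (a := t - 2 * G) (b := t + 2 * G) (by linarith) (by linarith)
  have hlog : Real.log (t + 2 * G) ≤ Real.log T + 1 := by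
    calc Real.log (t + 2 * G) ≤ Real.log (T * 2) := Real.log_le_log (by linarith) (by linarith)
      _ = Real.log T + Real.log 2 := Real.log_mul (by linarith) (by norm_num)
      _ ≤ _ := by linarith [Real.log_two_lt_d9]
  have h2 : (t + 2 * G - (t - 2 * G)) * (Real.log (t + 2 * G) + 2)
      ≤ 4 * G * (Real.log T + 4) := by
    have e : t + 2 * G - (t - 2 * G) = 4 * G := by ring
    rw [e]
    exact mul_le_mul_of_nonneg_left (by linarith) (by linarith)
  have hInt : ∀ a b : ℝ, IntervalIntegrable
      (fun t : ℝ => ‖riemannZeta (1 / 2 + (t : ℂ) * I)‖ ^ 2) MeasureTheory.volume a b :=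
    fun a b => (continuous_norm_riemannZeta_half.pow 2).intervalIntegrable a b
  have h3 : (∫ x in T..T + η, ‖riemannZeta (1 / 2 + (x : ℂ) * I)‖ ^ 2)
      ≤ ∫ x in (t - 2 * G)..(t + 2 * G), ‖riemannZeta (1 / 2 + (x : ℂ) * I)‖ ^ 2 :=
    intervalIntegral.integral_mono_interval (by linarith) (by linarith) (by linarith)
      (Eventually.of_forall fun x => by positivity) (hInt _ _)
  have h4 : (∫ _x in T..T + η, (V / 2) ^ 2)
      ≤ ∫ x in T..T + η, ‖riemannZeta (1 / 2 + (x : ℂ) * I)‖ ^ 2 := by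
    refine intervalIntegral.integral_mono_on (by linarith) (by simp) (hInt _ _) fun x hx => ?_
    exact pow_le_pow_left₀ (by positivity) (hlarge x hx.1 hx.2) 2
  rw [intervalIntegral.integral_const, add_sub_cancel_left, smul_eq_mul] at h4
  -- Half of the mass ηV²/4 pays for the main term; the other half is the conclusion.
  have e : η * (V / 2) ^ 2 = 2 * (η * V ^ 2 / 8) := by ring
  linarith

/-- Only the range |t - T| ≤ G and the first of the two summands are kept. -/
theorem shortMoment_ge {k : ℕ} {T G D : ℝ} (hG0 : 0 ≤ G) (hGT : G ≤ T / 6) (hD : 0 ≤ D)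
    (h : ∀ t, T - G ≤ t → t ≤ T + G → D ≤ zetaE (t + 2 * G) - zetaE (t - 2 * G)) :
    2 * G * D ^ k ≤ shortMoment k T G := by
  have hcont := continuous_zetaE
  have hInt : ∀ a b : ℝ, IntervalIntegrable (fun t : ℝ =>
      |zetaE (t + 2 * G) - zetaE (t - 2 * G)| ^ k + |zetaE (t + G / 2) - zetaE (t - G / 2)| ^ k)
      MeasureTheory.volume a b := fun a b => by
    apply Continuous.intervalIntegrable
    fun_prop
  have h1 : (∫ t in (T - G)..(T + G),
      (|zetaE (t + 2 * G) - zetaE (t - 2 * G)| ^ k + |zetaE (t + G / 2) - zetaE (t - G / 2)| ^ k))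
      ≤ shortMoment k T G :=
    intervalIntegral.integral_mono_interval (by linarith) (by linarith) (by linarith)
      (Eventually.of_forall fun x => by positivity) (hInt _ _)
  refine le_trans ?_ h1
  have h2 : (∫ _t in (T - G)..(T + G), D ^ k) = 2 * G * D ^ k := by
    rw [intervalIntegral.integral_const, smul_eq_mul]; ring
  rw [← h2]
  refine intervalIntegral.integral_mono_on (by linarith) (by simp) (hInt _ _) fun t ht => ?_
  have h3 : D ^ k ≤ |zetaE (t + 2 * G) - zetaE (t - 2 * G)| ^ k :=
    pow_le_pow_left₀ hD ((h t ht.1 ht.2).trans (le_abs_self _)) k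
  have : 0 ≤ |zetaE (t + G / 2) - zetaE (t - G / 2)| ^ k := by positivity
  linarith

/-- The numerical contradiction: a short-moment bound at a height with `V > T ^ A`. -/
theorem rpow_le_of_moment_bound {k : ℕ} {T V α β δ A K : ℝ} (hT : 1 ≤ T) (hV : T ^ A ≤ V)
    (hp : 0 ≤ 2 + 2 * (k : ℝ) - 2 * β)
    (h : 2 * (V ^ 2 * T ^ (-5 * δ)) * (T ^ (-3 * δ) * V ^ 2 / 8) ^ k
      ≤ K * (T ^ (α + δ) * (V ^ 2 * T ^ (-5 * δ)) ^ β)) :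
    2 * T ^ (A * (2 + 2 * (k : ℝ) - 2 * β))
      ≤ 8 ^ k * K * T ^ (α + δ * (1 + 5 * (1 - β) + 3 * k)) := by
  have hT0 : 0 < T := by linarith
  have hV0 : 0 < V := lt_of_lt_of_le (by positivity) hV
  set G := V ^ 2 * T ^ (-5 * δ) with hG
  have hG0 : 0 < G := by positivity
  -- The power is expanded exactly, since β may have either sign and bounds for G alone would not
  -- transfer.
  have hGβ : G ^ β = V ^ (2 * β) * T ^ (-5 * δ * β) := by
    rw [hG, Real.mul_rpow (by positivity) (by positivity), ← Real.rpow_mul hT0.le,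
      ← Real.rpow_natCast, ← Real.rpow_mul hV0.le]
    norm_num
  have hVp : V ^ (2 + 2 * (k : ℝ) - 2 * β) * V ^ (2 * β) = V ^ 2 * (V ^ 2) ^ k := by
    rw [← Real.rpow_add hV0, ← pow_mul, ← pow_add, ← Real.rpow_natCast]
    congr 1
    push_cast; ring
  have hTk : (T ^ (-3 * δ)) ^ k = T ^ (-3 * δ * k) := by
    rw [← Real.rpow_natCast, ← Real.rpow_mul hT0.le]
  have hdiv : (T ^ (-3 * δ) * V ^ 2 / 8) ^ k * 8 ^ k = T ^ (-3 * δ * k) * (V ^ 2) ^ k := by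
    rw [← mul_pow, div_mul_cancel₀ _ (by norm_num), mul_pow, hTk]
  have h1 := mul_le_mul_of_nonneg_right h (by positivity : (0 : ℝ) ≤ 8 ^ k)
  have e1 : 2 * G * (T ^ (-3 * δ) * V ^ 2 / 8) ^ k * 8 ^ k
      = (V ^ (2 * β) * T ^ (-5 * δ + -3 * δ * k)) * (2 * V ^ (2 + 2 * (k : ℝ) - 2 * β)) := by
    rw [mul_assoc, hdiv, hG, Real.rpow_add hT0]
    linear_combination (-2 * (T ^ (-5 * δ) * T ^ (-3 * δ * k))) * hVp
  have e2 : K * (T ^ (α + δ) * G ^ β) * 8 ^ k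
      = (V ^ (2 * β) * T ^ (-5 * δ + -3 * δ * k))
        * (8 ^ k * K * T ^ (α + δ * (1 + 5 * (1 - β) + 3 * k))) := by
    have : T ^ (-5 * δ + -3 * δ * k) * T ^ (α + δ * (1 + 5 * (1 - β) + 3 * k))
        = T ^ (α + δ) * T ^ (-5 * δ * β) := by
      rw [← Real.rpow_add hT0, ← Real.rpow_add hT0]
      congr 1
      ring
    rw [hGβ]
    linear_combination (-(V ^ (2 * β) * 8 ^ k * K)) * this
  rw [e1, e2] at h1
  have h2 := le_of_mul_le_mul_left h1 (by positivity)
  refine le_trans ?_ h2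
  rw [Real.rpow_mul hT0.le]
  gcongr

/-- Values of zeta close to its order on the critical line are incompatible with a strong bound
for the short moments of `E`. -/
theorem false_of_moment_bound {k : ℕ} {α β C A δ : ℝ} (hβ : β ≤ (k : ℝ) - 1) (hC : 0 < C)
    (hbound : ∀ ε : ℝ, 0 < ε → ∃ K T₀ : ℝ, ∀ T G : ℝ, T₀ ≤ T → T ^ ε ≤ G →
      G ≤ C * T ^ (1 / 3 : ℝ) → shortMoment k T G ≤ K * (T ^ (α + ε) * G ^ β))
    (hδ : 0 < δ) (hδA : 3 * δ ≤ A) (hA6 : A ≤ 1 / 6)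
    (hAp : α + δ * (1 + 5 * (1 - β) + 3 * k) < A * (2 + 2 * (k : ℝ) - 2 * β))
    (hle : ZetaOrderLE (A + δ)) (hnot : ¬ ZetaOrderLE A) : False := by
  obtain ⟨K, T₀, hK⟩ := hbound δ hδ
  obtain ⟨K₂, hK₂0, hK₂⟩ := hle.exists_norm_le
  obtain ⟨K₃, hK₃0, hK₃⟩ := hle.exists_norm_sub_le (by linarith) (by linarith) hδ (by linarith)
  have hfreq := frequently_rpow_lt_of_not_zetaOrderLE (by linarith) hnot
  have hev : ∀ᶠ T : ℝ in atTop, T₀ ≤ T ∧ 1 ≤ T ∧ 2 * K₃ ≤ T ^ δ ∧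
      32 * (Real.log T + 4) ≤ T ^ (2 * δ) ∧ (K₂ * 2 ^ (A + δ)) ^ 2 / C ≤ T ^ (3 * δ) ∧
      6 * C ≤ T ^ (2 / 3 : ℝ) ∧ 8 ^ k * K ≤ T ^ (A * (2 + 2 * (k : ℝ) - 2 * β)
        - (α + δ * (1 + 5 * (1 - β) + 3 * k))) := by
    filter_upwards [eventually_ge_atTop T₀, eventually_ge_atTop 1, eventually_le_rpow (2 * K₃) hδ,
      eventually_log_add_le_rpow (by linarith : 0 < 2 * δ),
      eventually_le_rpow ((K₂ * 2 ^ (A + δ)) ^ 2 / C) (by linarith : 0 < 3 * δ),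
      eventually_le_rpow (6 * C) (by norm_num : (0 : ℝ) < 2 / 3),
      eventually_le_rpow (8 ^ k * K) (sub_pos.mpr hAp)] with T a b c d e f g
    exact ⟨a, b, c, d, e, f, g⟩
  obtain ⟨T, hVT, hT₀, hT1, hc3, hclog, hc2, hcC, hcK⟩ := (hfreq.and_eventually hev).exists
  have hT0 : 0 < T := by linarith
  set V := ‖riemannZeta (1 / 2 + (T : ℂ) * I)‖ with hV
  have hV0 : 0 < V := lt_of_le_of_lt (by positivity) hVT
  -- The derivative is at most of order T^(A + 2δ), so over a length T^(-3δ) the value moves by less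
  -- than T^A/2 once T^δ absorbs the constant.
  set η := T ^ (-3 * δ) with hη
  have hη0 : 0 < η := by positivity
  have hη1 : η ≤ 1 := Real.rpow_le_one_of_one_le_of_nonpos hT1 (by linarith)
  -- Smaller than ηV² by T^(-2δ), which absorbs the logarithm in the main term. Since T^A < V ≪ T^(A
  -- + δ), 3δ ≤ A gives G ≥ T^δ and A ≤ 1/6 gives G ≤ C T^(1/3).
  set G := V ^ 2 * T ^ (-5 * δ) with hG
  have hG0 : 0 < G := by positivity
  have hGlo : T ^ δ ≤ G := by
    calc T ^ δ ≤ T ^ (A + A + -5 * δ) := Real.rpow_le_rpow_of_exponent_le hT1 (by linarith)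
      _ = (T ^ A) ^ 2 * T ^ (-5 * δ) := by rw [Real.rpow_add hT0, Real.rpow_add hT0]; ring
      _ ≤ G := by rw [hG]; gcongr
  have hG1 : 1 ≤ G := (Real.one_le_rpow hT1 hδ.le).trans hGlo
  have hVhi : V ≤ K₂ * 2 ^ (A + δ) * T ^ (A + δ) := by
    refine (hK₂ T).trans ?_
    rw [mul_assoc, ← Real.mul_rpow (by norm_num) hT0.le, abs_of_nonneg hT0.le]
    gcongr
    · linarith
    · linarith
  have hGhi : G ≤ C * T ^ (1 / 3 : ℝ) := by
    calc G ≤ (K₂ * 2 ^ (A + δ) * T ^ (A + δ)) ^ 2 * T ^ (-5 * δ) := by rw [hG]; gcongr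
      _ = (K₂ * 2 ^ (A + δ)) ^ 2 * T ^ (A + δ + (A + δ) + -5 * δ) := by
        rw [Real.rpow_add hT0 (A + δ + (A + δ)), Real.rpow_add hT0 (A + δ) (A + δ)]; ring
      _ ≤ (C * T ^ (3 * δ)) * T ^ (A + δ + (A + δ) + -5 * δ) := by
        gcongr
        rw [div_le_iff₀ hC] at hc2
        linarith
      _ = C * T ^ (3 * δ + (A + δ + (A + δ) + -5 * δ)) := by
        rw [Real.rpow_add hT0 (3 * δ), mul_assoc]
      _ ≤ _ := by
        refine mul_le_mul_of_nonneg_left (Real.rpow_le_rpow_of_exponent_le hT1 ?_) hC.le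
        linarith
  have hGT : G ≤ T / 6 := by
    have h1 : T ^ (1 / 3 : ℝ) * T ^ (2 / 3 : ℝ) = T := by
      rw [← Real.rpow_add hT0]; norm_num
    have h2 := mul_le_mul_of_nonneg_left hcC (by positivity : 0 ≤ T ^ (1 / 3 : ℝ))
    rw [h1] at h2
    linarith
  have hlarge : ∀ x, T ≤ x → x ≤ T + η → V / 2 ≤ ‖riemannZeta (1 / 2 + (x : ℂ) * I)‖ := by
    intro x hx1 hx2
    have h1 := hK₃ T x hT1 hx1 (by linarith)
    have h2 : K₃ * T ^ (A + δ + δ) * (x - T) ≤ V / 2 := by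
      have h3 : 2 * (K₃ * T ^ (A + δ + δ) * (x - T)) ≤ T ^ A := by
        calc 2 * (K₃ * T ^ (A + δ + δ) * (x - T))
            ≤ 2 * (K₃ * T ^ (A + δ + δ) * η) := by gcongr; linarith
          _ = (2 * K₃) * (T ^ (A + δ + δ) * η) := by ring
          _ ≤ T ^ δ * (T ^ (A + δ + δ) * η) := by gcongr
          _ = T ^ A := by
            rw [hη, ← Real.rpow_add hT0, ← Real.rpow_add hT0]
            congr 1; ring
      linarith
    have h4 := norm_sub_norm_le (riemannZeta (1 / 2 + (T : ℂ) * I))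
      (riemannZeta (1 / 2 + (x : ℂ) * I))
    rw [norm_sub_rev] at h4
    linarith
  have hmain : 4 * G * (Real.log T + 4) ≤ η * V ^ 2 / 8 := by
    have h1 : T ^ (-5 * δ) * T ^ (2 * δ) = η := by
      rw [hη, ← Real.rpow_add hT0]; congr 1; ring
    calc 4 * G * (Real.log T + 4) = V ^ 2 * T ^ (-5 * δ) * (32 * (Real.log T + 4)) / 8 := by
          rw [hG]; ring
      _ ≤ V ^ 2 * T ^ (-5 * δ) * T ^ (2 * δ) / 8 := by gcongr
      _ = η * V ^ 2 / 8 := by rw [← h1]; ring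
  have hSM := shortMoment_ge (k := k) hG0.le hGT (by positivity : 0 ≤ η * V ^ 2 / 8)
    fun t h1 h2 => zetaE_increment_ge hT1 hη0.le (hη1.trans hG1) hGT hV0.le h1 h2 hlarge hmain
  have hfin := rpow_le_of_moment_bound hT1 hVT.le (by linarith) (hSM.trans (hK T G hT₀ hGlo hGhi))
  rw [Real.rpow_sub hT0, le_div_iff₀ (by positivity)] at hcK
  have hpos : 0 < T ^ (A * (2 + 2 * (k : ℝ) - 2 * β)) := by positivity
  linarith

/-- The pointwise consequence of a short-moment bound. -/
theorem zetaOrderLE_of_moment_bound {k : ℕ} {α β C : ℝ} (hα : 0 < α) (hβ : β ≤ (k : ℝ) - 1)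
    (hC : 0 < C)
    (hbound : ∀ ε : ℝ, 0 < ε → ∃ K T₀ : ℝ, ∀ T G : ℝ, T₀ ≤ T → T ^ ε ≤ G →
      G ≤ C * T ^ (1 / 3 : ℝ) → shortMoment k T G ≤ K * (T ^ (α + ε) * G ^ β))
    {ε : ℝ} (hε : 0 < ε) : ZetaOrderLE ((α + ε) / (2 + 2 * (k : ℝ) - 2 * β)) := by
  set p := 2 + 2 * (k : ℝ) - 2 * β with hp
  have hp4 : 4 ≤ p := by linarith
  by_contra hnot
  set A₁ := (α + ε) / p with hA₁
  have hA₁0 : 0 < A₁ := by positivity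
  have hA₁p : A₁ * p = α + ε := div_mul_cancel₀ _ (by linarith)
  have hlb : ∀ B ∈ {B : ℝ | ZetaOrderLE B}, A₁ ≤ B := by
    intro B hB
    by_contra! hlt
    exact hnot (ZetaOrderLE.mono hB hlt.le)
  have hbdd : BddBelow {B : ℝ | ZetaOrderLE B} := ⟨A₁, hlb⟩
  have hne : {B : ℝ | ZetaOrderLE B}.Nonempty := ⟨1, zetaOrderLE_of_one_sixth_lt (by norm_num)⟩
  set A₀ := sInf {B : ℝ | ZetaOrderLE B} with hA₀
  have hA₀1 : A₁ ≤ A₀ := le_csInf hne hlb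
  have hA₀6 : A₀ ≤ 1 / 6 :=
    le_of_forall_gt_imp_ge_of_dense fun B hB => csInf_le hbdd (zetaOrderLE_of_one_sixth_lt hB)
  set c := |1 + 5 * (1 - β) + 3 * (k : ℝ)| with hc
  -- The first entry secures 3δ ≤ A₀ - δ/2; the second makes all losses of order δ, including pδ/2,
  -- smaller than ε.
  set δ := min (A₁ / 4) (ε / (p + c)) with hδ
  have hδ0 : 0 < δ := by positivity
  have hδ1 : δ ≤ A₁ / 4 := min_le_left _ _
  have hδ2 : δ * (p + c) ≤ ε := by
    rw [← le_div_iff₀ (by positivity)]; exact min_le_right _ _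
  have hδc : δ * (1 + 5 * (1 - β) + 3 * k) ≤ δ * c := by gcongr; exact le_abs_self _
  -- The exponent A₀ - δ/2 lies below the infimum while A₀ + δ/2 lies above it.
  refine false_of_moment_bound (A := A₀ - δ / 2) (δ := δ) hβ hC hbound hδ0 (by linarith)
    (by linarith) ?_ ?_ ?_
  · rw [← hp]
    nlinarith
  · obtain ⟨B, hB, hBlt⟩ := exists_lt_of_csInf_lt hne (by linarith : A₀ < A₀ - δ / 2 + δ)
    exact ZetaOrderLE.mono hB hBlt.le
  · intro h
    have : A₀ ≤ A₀ - δ / 2 := csInf_le hbdd h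
    linarith

/-! ### From the pointwise bound to the moment. -/

theorem ZetaOrderLE.exists_integral_le {A p : ℝ} (hA : 0 ≤ A) (hp : 0 ≤ p) (h : ZetaOrderLE A) :
    ∃ K : ℝ, ∀ T : ℝ, 1 ≤ T →
      (∫ t in (0 : ℝ)..T, ‖riemannZeta (1 / 2 + (t : ℂ) * I)‖ ^ p) ≤ K * T ^ (1 + A * p) := by
  obtain ⟨K, hK0, hK⟩ := h.exists_norm_le
  refine ⟨K ^ p * 2 ^ (A * p), fun T hT => ?_⟩
  have hT0 : 0 < T := by linarith
  have hle : ∀ t ∈ Set.uIoc 0 T, ‖‖riemannZeta (1 / 2 + (t : ℂ) * I)‖ ^ p‖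
      ≤ K ^ p * 2 ^ (A * p) * T ^ (A * p) := by
    intro t ht
    rw [Set.uIoc_of_le hT0.le] at ht
    rw [Real.norm_of_nonneg (by positivity), mul_assoc, ← Real.mul_rpow (by norm_num) hT0.le,
      Real.rpow_mul (by positivity), ← Real.mul_rpow hK0.le (by positivity)]
    gcongr
    refine (hK t).trans ?_
    rw [abs_of_pos ht.1]
    have : 1 + t ≤ 2 * T := by linarith [ht.2]
    have := ht.1
    gcongr
  have := (le_abs_self _).trans (intervalIntegral.norm_integral_le_of_norm_le_const hle)
  refine this.trans (le_of_eq ?_)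
  rw [sub_zero, abs_of_pos hT0, Real.rpow_add hT0, Real.rpow_one]
  ring

theorem corollary4 (k : ℕ) (hk : 1 ≤ k) (α β : ℝ) (hα : 0 < α) (hβ : β ≤ (k : ℝ) - 1)
    (C : ℝ) (hC : 0 < C)
    (hbound : ∀ ε : ℝ, 0 < ε → ∃ K T₀ : ℝ, ∀ T G : ℝ, T₀ ≤ T → T ^ ε ≤ G →
      G ≤ C * T ^ (1 / 3 : ℝ) → shortMoment k T G ≤ K * (T ^ (α + ε) * G ^ β)) :
    ∀ ε : ℝ, 0 < ε → ∃ K : ℝ, ∀ T : ℝ, 1 ≤ T →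
      (∫ t in (0 : ℝ)..T,
        ‖riemannZeta (1 / 2 + (t : ℂ) * Complex.I)‖ ^ (2 + 2 * (k : ℝ) - 2 * β)) ≤
        K * T ^ (1 + α + ε) := by
  intro ε hε
  have hp : 0 < 2 + 2 * (k : ℝ) - 2 * β := by linarith
  obtain ⟨K, hK⟩ := (zetaOrderLE_of_moment_bound hα hβ hC hbound hε).exists_integral_le
    (by positivity) hp.le
  rw [div_mul_cancel₀ _ hp.ne', ← add_assoc] at hK
  exact ⟨K, hK⟩
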